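/- **Setting.** Let $(\mathcal K,\Sigma,\otimes,\mathbb 1)$ be an (essentially small) tensor triangulated category: a triangulated category with a symmetric monoidal structure and natural isomorphisms $\Sigma a\otimes b\simeq\Sigma(a\otimes b)\simeq a\otimes\Sigma b$, compatible with the associator, the unitors and the symmetry, such that $a\otimes-$ and $-\otimes a$ are exact and the two resulting isomorphisms $\Sigma a\otimes\Sigma b\simeq\Sigma^2(a\otimes b)$ differ by the sign $-1$. Let $\mathrm{Spc}(\mathcal K)$ be the set of prime ideals of $\mathcal K$ (proper thick $\otimes$-ideals $\mathcal P$ such that $a\otimes b\in\mathcal P$ implies $a\in\mathcal P$ or $b\in\mathcal P$), with the topology for which the sets $\mathrm{supp}(a)=\{\mathcal P : a\notin\mathcal P\}$ form a basis of closed sets. Let $\Phi$ be a non-empty set of objects of $\mathcal K$ closed under $\otimes$, and let $\mathcal Z_\Phi=\bigcap_{X\in\Phi}\mathrm{supp}(X)$ with the subspace topology. For an object $X$ and $n\in\mathbb Z$ let $[X,X]_n=\mathrm{Hom}(\Sigma^nX,X)$, with graded product $f\cdot g=f\circ\Sigma^m g$ for $f\in[X,X]_m$, and let $E_X^n\subset[X,X]_n$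 be the subgroup of those $f$ with $f\otimes X=X\otimes f$, where the suspension isomorphisms are used to view $f\otimes X$ and $X\otimes f$ as elements of $[X\otimes X,X\otimes X]_n$. Let $E_X=\{f\in\mathrm{End}(X): f\otimes X=X\otimes f\}$. Let $R_\Phi^n$ be the set of pairs $(X,f)$ with $X\in\Phi$, $f\in E_X^n$, modulo the smallest equivalence relation with $(X,f)\sim(a\otimes X,a\otimes f)$ and $(X,f)\sim(X\otimes a,f\otimes a)$ for all $a\in\Phi$; write $[f]=[f_X]$ for the class of $(X,f)$. Let $R_\Phi$ be the analogous quotient formed from the $E_X$; it is a commutative ring with $[f_X]+[g_Y]=[f\otimes Y+X\otimes g]$ and $[f_X][g_Y]=[(f\otimes Y)\circ(X\otimes g)]$. For a graded-commutative $\mathbb Z$-graded ring $R^\bullet$ let $\mathrm{Spec}^h(R^\bullet)$ be the set of homogeneous prime ideals (proper homogeneous ideals $\mathfrak p$ such that, for homogeneous $a,b$, $ab\in\mathfrak p$ implies $a\in\mathfrak p$ or $b\in\mathfrak p$) with the Zariski topology. A spectral map is a continuous map between spectral spaces for which preimages of quasi-compact open sets are quasi-compact. **Theorem.** 1. There is a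 graded-commutative graded ring $R_\Phi^\bullet$ with homogeneous components $R_\Phi^n$ ($n\in\mathbb Z$), addition $[f_X]+[g_Y]=[f\otimes Y+X\otimes g]$ (for $f\in E_X^n$, $g\in E_Y^n$) and multiplication $[f_X]\cdot[g_Y]=[(f\otimes Y)\cdot(X\otimes g)]$ (for $f\in E_X^m$, $g\in E_Y^n$). The identification $\mathrm{End}(X)\cong[X,X]_0$ induces a ring isomorphism $R_\Phi\cong R_\Phi^0$. 2. There is an inclusion-reversing spectral map $\rho_\Phi^\bullet:\mathcal Z_\Phi\to\mathrm{Spec}^h(R_\Phi^\bullet)$, where $\rho_\Phi^\bullet(\mathcal P)$ is the homogeneous prime ideal whose degree-$n$ part is $\{[f]\in R_\Phi^n : \mathrm{cone}(f)\notin\mathcal P\}$; the condition does not depend on the representative $f$ of $[f]$. 3. $\mathfrak p\mapsto\mathfrak p\cap R_\Phi^0$ defines a surjective spectral map $\mathrm{Spec}^h(R_\Phi^\bullet)\to\mathrm{Spec}(R_\Phi)$, and its composite with $\rho_\Phi^\bullet$ is the ungraded comparison map $\rho_\Phi:\mathcal Z_\Phi\to\mathrm{Spec}(R_\Phi)$,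 $\rho_\Phi(\mathcal P)=\{[f]\in R_\Phi : \mathrm{cone}(f)\notin\mathcal P\}$. -/

import Mathlib

open CategoryTheory CategoryTheory.Limits CategoryTheory.MonoidalCategory
  CategoryTheory.Pretriangulated

universe v u

set_option linter.unusedSectionVars false

namespace TensorTriangular

noncomputable section

/-! ### Tensor triangulated categories -/

section ShiftIsos

variable {C : Type u} [Category.{v} C] [Preadditive C] [HasShift C ℤ]
  [∀ n : ℤ, (shiftFunctor C n).Additive] [MonoidalCategory C]
  [(curriedTensor C).CommShift₂Int]

/-- The suspension isomorphism `a ⊗ Σⁿ b ≅ Σⁿ (a ⊗ b)`. -/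
def shiftTensorLeft (a b : C) (n : ℤ) : a ⊗ b⟦n⟧ ≅ (a ⊗ b)⟦n⟧ :=
  ((tensorLeft a).commShiftIso n).app b

/-- The suspension isomorphism `Σⁿ a ⊗ b ≅ Σⁿ (a ⊗ b)`. -/
def shiftTensorRight (a b : C) (n : ℤ) : a⟦n⟧ ⊗ b ≅ (a ⊗ b)⟦n⟧ :=
  ((tensorRight b).commShiftIso n).app a

end ShiftIsos

/-- A tensor triangulated category: a triangulated category with a symmetric monoidal structure
and with suspension isomorphisms `a ⊗ Σⁿ b ≅ Σⁿ (a ⊗ b)` and `Σⁿ a ⊗ b ≅ Σⁿ (a ⊗ b)` that are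
natural in both variables and anti-commute for `Σ a ⊗ Σ b` (all this is the datum
`(curriedTensor C).CommShift₂Int`), such that the functors `a ⊗ -` and `- ⊗ a` are exact and
the suspension isomorphisms are compatible with the unitors, the associator and the symmetry. -/
class IsTensorTriangulated (C : Type u) [Category.{v} C] [Preadditive C] [HasZeroObject C]
    [HasShift C ℤ] [∀ n : ℤ, (shiftFunctor C n).Additive] [Pretriangulated C] [IsTriangulated C]
    [MonoidalCategory C] [SymmetricCategory C] [(curriedTensor C).CommShift₂Int] : Prop where
  tensorLeft_exact (a : C) : (tensorLeft a).IsTriangulated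
  tensorRight_exact (a : C) : (tensorRight a).IsTriangulated
  leftUnitor_shift (a : C) (n : ℤ) :
    (shiftTensorLeft (𝟙_ C) a n).hom ≫ (λ_ a).hom⟦n⟧' = (λ_ (a⟦n⟧)).hom
  rightUnitor_shift (a : C) (n : ℤ) :
    (shiftTensorRight a (𝟙_ C) n).hom ≫ (ρ_ a).hom⟦n⟧' = (ρ_ (a⟦n⟧)).hom
  associator_shift₁ (a b c : C) (n : ℤ) :
    (α_ (a⟦n⟧) b c).hom ≫ (shiftTensorRight a (b ⊗ c) n).hom =
      (shiftTensorRight a b n).hom ▷ c ≫ (shiftTensorRight (a ⊗ b) c n).hom ≫ (α_ a b c).hom⟦n⟧'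
  associator_shift₂ (a b c : C) (n : ℤ) :
    (α_ a (b⟦n⟧) c).hom ≫ a ◁ (shiftTensorRight b c n).hom ≫ (shiftTensorLeft a (b ⊗ c) n).hom =
      (shiftTensorLeft a b n).hom ▷ c ≫ (shiftTensorRight (a ⊗ b) c n).hom ≫ (α_ a b c).hom⟦n⟧'
  associator_shift₃ (a b c : C) (n : ℤ) :
    (α_ a b (c⟦n⟧)).hom ≫ a ◁ (shiftTensorLeft b c n).hom ≫ (shiftTensorLeft a (b ⊗ c) n).hom =
      (shiftTensorLeft (a ⊗ b) c n).hom ≫ (α_ a b c).hom⟦n⟧'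
  braiding_shift (a b : C) (n : ℤ) :
    (β_ a (b⟦n⟧)).hom ≫ (shiftTensorRight b a n).hom =
      (shiftTensorLeft a b n).hom ≫ (β_ a b).hom⟦n⟧'

attribute [instance] IsTensorTriangulated.tensorLeft_exact IsTensorTriangulated.tensorRight_exact

/-! ### The spectrum of a tensor triangulated category -/

section Spectrum

variable (C : Type u) [Category.{v} C] [Preadditive C] [HasZeroObject C]
  [HasShift C ℤ] [∀ n : ℤ, (shiftFunctor C n).Additive] [Pretriangulated C] [MonoidalCategory C]

/-- The set `Spc(C)` of prime ideals of `C`: the proper thick tensor ideals `P` such that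
`a ⊗ b ∈ P` implies `a ∈ P` or `b ∈ P`. -/
structure Spc where
  /-- membership in the prime ideal -/
  carrier : ObjectProperty C
  isTriangulated : carrier.IsTriangulated
  thick : carrier.IsStableUnderRetracts
  tensor_mem (a b : C) : carrier b → carrier (a ⊗ b)
  proper : ∃ a : C, ¬ carrier a
  prime (a b : C) : carrier (a ⊗ b) → carrier a ∨ carrier b

variable {C}

/-- The support of an object. -/
def supp (a : C) : Set (Spc C) := {P | ¬ P.carrier a}

/-- The Balmer topology: the supports of objects form a basis of closed sets. -/
instance : TopologicalSpace (Spc C) :=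
  TopologicalSpace.generateFrom {U | ∃ a : C, U = (supp a)ᶜ}

/-- The closed subset `Z_Φ = ⋂ X ∈ Φ, supp X`. -/
def suppFamily (Φ : Set C) : Set (Spc C) := ⋂ X ∈ Φ, supp X


end Spectrum

/-- The cone of a morphism (well defined up to isomorphism). -/
def cone {C : Type u} [Category.{v} C] [Preadditive C] [HasZeroObject C]
    [HasShift C ℤ] [∀ n : ℤ, (shiftFunctor C n).Additive] [Pretriangulated C]
    {X Y : C} (f : X ⟶ Y) : C :=
  (distinguished_cocone_triangle f).choose

/-! ### The ungraded ring -/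

section Ungraded

variable {C : Type u} [Category.{v} C] [Preadditive C] [HasZeroObject C]
  [HasShift C ℤ] [∀ n : ℤ, (shiftFunctor C n).Additive] [Pretriangulated C] [IsTriangulated C]
  [MonoidalCategory C] [SymmetricCategory C] [(curriedTensor C).CommShift₂Int]
  [IsTensorTriangulated C]

/-- The ring `E_X` of `⊗`-balanced endomorphisms of `X`. -/
def balancedEnd (X : C) : Subring (End X) where
  carrier := {f | f ▷ X = X ◁ f}
  mul_mem' {f g} hf hg := by
    change f ▷ X = X ◁ f at hf
    change g ▷ X = X ◁ g at hg
    change (g ≫ f) ▷ X = X ◁ (g ≫ f)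
    rw [comp_whiskerRight, MonoidalCategory.whiskerLeft_comp, hf, hg]
  one_mem' := by
    change (𝟙 X) ▷ X = X ◁ (𝟙 X)
    simp
  add_mem' {f g} hf hg := by
    change (tensorRight X).map (f + g) = (tensorLeft X).map (f + g)
    rw [Functor.map_add, Functor.map_add]
    exact congrArg₂ (· + ·) hf hg
  zero_mem' := by
    change (tensorRight X).map 0 = (tensorLeft X).map 0
    rw [Functor.map_zero, Functor.map_zero]
  neg_mem' {f} hf := by
    change (tensorRight X).map (-f) = (tensorLeft X).map (-f)
    rw [Functor.map_neg, Functor.map_neg]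
    exact congrArg (fun t => -t) hf

lemma isIso_tensorμ (X Y Z W : C) : IsIso (tensorμ X Y Z W) :=
  ⟨tensorδ X Y Z W, tensorμ_tensorδ X Y Z W, tensorδ_tensorμ X Y Z W⟩

/-- `f ↦ f ⊗ Y`, from `E_X` to `E_{X ⊗ Y}`. -/
def balancedEnd.tensorRight {X : C} (f : balancedEnd X) (Y : C) : balancedEnd (X ⊗ Y) :=
  ⟨f.1 ▷ Y, by
    have hf : f.1 ▷ X = X ◁ f.1 := f.2
    change (f.1 ▷ Y) ▷ (X ⊗ Y) = (X ⊗ Y) ◁ (f.1 ▷ Y)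
    have h := isIso_tensorμ X Y X Y
    rw [← cancel_mono (tensorμ X Y X Y)]
    have h1 := tensorμ_natural f.1 (𝟙 Y) (𝟙 X) (𝟙 Y)
    have h2 := tensorμ_natural (𝟙 X) (𝟙 Y) f.1 (𝟙 Y)
    simp only [tensorHom_id, id_tensorHom, id_whiskerRight] at h1 h2
    rw [h1, h2, hf]⟩

/-- `f ↦ a ⊗ f`, from `E_X` to `E_{a ⊗ X}`. -/
def balancedEnd.tensorLeft (a : C) {X : C} (f : balancedEnd X) : balancedEnd (a ⊗ X) :=
  ⟨a ◁ f.1, by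
    have hf : f.1 ▷ X = X ◁ f.1 := f.2
    change (a ◁ f.1) ▷ (a ⊗ X) = (a ⊗ X) ◁ (a ◁ f.1)
    have h := isIso_tensorμ a X a X
    rw [← cancel_mono (tensorμ a X a X)]
    have h1 := tensorμ_natural (𝟙 a) f.1 (𝟙 a) (𝟙 X)
    have h2 := tensorμ_natural (𝟙 a) (𝟙 X) (𝟙 a) f.1
    simp only [tensorHom_id, id_tensorHom, id_whiskerRight] at h1 h2
    rw [h1, h2, hf]⟩

end Ungraded

/-! ### Graded endomorphisms -/

section Graded

variable {C : Type u} [Category.{v} C] [Preadditive C] [HasZeroObject C]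
  [HasShift C ℤ] [∀ n : ℤ, (shiftFunctor C n).Additive] [Pretriangulated C] [IsTriangulated C]
  [MonoidalCategory C] [SymmetricCategory C] [(curriedTensor C).CommShift₂Int]
  [IsTensorTriangulated C]

/-- The group `[X, X]_n` of graded endomorphisms `Σⁿ X ⟶ X` of degree `n`. -/
abbrev GrEnd (X : C) (n : ℤ) : Type v := X⟦n⟧ ⟶ X

namespace GrEnd

/-- The graded product: `f · g` is the composite `Σ^(m+n) X ≅ Σ^m Σ^n X ⟶ Σ^m X ⟶ X`
of `Σ^m g` and `f`. -/
def mul {X : C} {m n : ℤ} (f : GrEnd X m) (g : GrEnd X n) : GrEnd X (m + n) :=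
  (shiftFunctorAdd' C n m (m + n) (add_comm n m)).hom.app X ≫ g⟦m⟧' ≫ f

/-- The endomorphism `f ⊗ Y` of `X ⊗ Y`, namely `Σⁿ (X ⊗ Y) ≅ Σⁿ X ⊗ Y ⟶ X ⊗ Y`. -/
def tensorRight {X : C} {n : ℤ} (f : GrEnd X n) (Y : C) : GrEnd (X ⊗ Y) n :=
  (shiftTensorRight X Y n).inv ≫ f ▷ Y

/-- The endomorphism `a ⊗ f` of `a ⊗ X`, namely `Σⁿ (a ⊗ X) ≅ a ⊗ Σⁿ X ⟶ a ⊗ X`. -/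
def tensorLeft (a : C) {X : C} {n : ℤ} (f : GrEnd X n) : GrEnd (a ⊗ X) n :=
  (shiftTensorLeft a X n).inv ≫ a ◁ f

/-- `φ` intertwines the graded endomorphisms `f` and `g`. -/
def Intertwines {X Y : C} (φ : X ⟶ Y) {n : ℤ} (f : GrEnd X n) (g : GrEnd Y n) : Prop :=
  φ⟦n⟧' ≫ g = f ≫ φ

lemma Intertwines.comp {X Y Z : C} {φ : X ⟶ Y} {ψ : Y ⟶ Z} {n : ℤ} {f : GrEnd X n}
    {g : GrEnd Y n} {h : GrEnd Z n} (h₁ : Intertwines φ f g) (h₂ : Intertwines ψ g h) :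
    Intertwines (φ ≫ ψ) f h := by
  unfold Intertwines at *
  rw [Functor.map_comp, Category.assoc, h₂, reassoc_of% h₁]

lemma Intertwines.inv {X Y : C} {φ : X ≅ Y} {n : ℤ} {f : GrEnd X n}
    {g : GrEnd Y n} (h : Intertwines φ.hom f g) : Intertwines φ.inv g f := by
  unfold Intertwines at *
  rw [← cancel_mono φ.hom, Category.assoc, ← h, ← Functor.map_comp_assoc]
  simp

lemma Intertwines.eq {X Y : C} {φ : X ⟶ Y} [IsIso φ] {n : ℤ} {f f' : GrEnd X n}
    {g : GrEnd Y n} (h : Intertwines φ f g) (h' : Intertwines φ f' g) : f = f' := by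
  unfold Intertwines at *
  rw [← cancel_mono φ, ← h, h']

lemma shiftTensorRight_inv_natural {X Y : C} (φ : X ⟶ Y) (Z : C) (n : ℤ) :
    (φ ▷ Z)⟦n⟧' ≫ (shiftTensorRight Y Z n).inv = (shiftTensorRight X Z n).inv ≫ φ⟦n⟧' ▷ Z :=
  Functor.commShiftIso_inv_naturality (CategoryTheory.MonoidalCategory.tensorRight Z) φ n

lemma shiftTensorLeft_inv_natural {X Y : C} (φ : X ⟶ Y) (Z : C) (n : ℤ) :
    (Z ◁ φ)⟦n⟧' ≫ (shiftTensorLeft Z Y n).inv = (shiftTensorLeft Z X n).inv ≫ Z ◁ φ⟦n⟧' :=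
  Functor.commShiftIso_inv_naturality (CategoryTheory.MonoidalCategory.tensorLeft Z) φ n

lemma shiftTensorRight_inv_natural' {Y Z : C} (X : C) (φ : Y ⟶ Z) (n : ℤ) :
    (X ◁ φ)⟦n⟧' ≫ (shiftTensorRight X Z n).inv = (shiftTensorRight X Y n).inv ≫ X⟦n⟧ ◁ φ := by
  rw [Iso.comp_inv_eq, Category.assoc, Iso.eq_inv_comp]
  exact NatTrans.shift_app_comm ((curriedTensor C).flip.map φ) n X

lemma Intertwines.whiskerRight {X Y : C} {φ : X ⟶ Y} {n : ℤ} {f : GrEnd X n}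
    {g : GrEnd Y n} (h : Intertwines φ f g) (Z : C) :
    Intertwines (φ ▷ Z) (f.tensorRight Z) (g.tensorRight Z) := by
  unfold Intertwines tensorRight at *
  rw [← Category.assoc, shiftTensorRight_inv_natural, Category.assoc, Category.assoc,
    ← comp_whiskerRight, h, comp_whiskerRight]

lemma Intertwines.whiskerLeft {X Y : C} {φ : X ⟶ Y} {n : ℤ} {f : GrEnd X n}
    {g : GrEnd Y n} (h : Intertwines φ f g) (Z : C) :
    Intertwines (Z ◁ φ) (f.tensorLeft Z) (g.tensorLeft Z) := by
  unfold Intertwines tensorLeft at *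
  rw [← Category.assoc, shiftTensorLeft_inv_natural, Category.assoc, Category.assoc,
    ← MonoidalCategory.whiskerLeft_comp, h, MonoidalCategory.whiskerLeft_comp]

lemma intertwines_whiskerLeft {X Y Z : C} (φ : Y ⟶ Z) {n : ℤ} (f : GrEnd X n) :
    Intertwines (X ◁ φ) (f.tensorRight Y) (f.tensorRight Z) := by
  unfold Intertwines tensorRight
  rw [← Category.assoc, shiftTensorRight_inv_natural', Category.assoc, Category.assoc,
    whisker_exchange]

lemma intertwines_braiding (a X : C) {n : ℤ} (f : GrEnd X n) :
    Intertwines (β_ a X).hom (f.tensorLeft a) (f.tensorRight a) := by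
  unfold Intertwines tensorRight tensorLeft
  rw [Category.assoc, BraidedCategory.braiding_naturality_right, ← Category.assoc,
    ← Category.assoc]
  congr 1
  rw [Iso.comp_inv_eq, Category.assoc, Iso.eq_inv_comp]
  exact (IsTensorTriangulated.braiding_shift a X n).symm

lemma intertwines_associator₁ (X b c : C) {n : ℤ} (f : GrEnd X n) :
    Intertwines (α_ X b c).hom ((f.tensorRight b).tensorRight c) (f.tensorRight (b ⊗ c)) := by
  have := IsTensorTriangulated.associator_shift₁ X b c n
  unfold Intertwines tensorRight
  rw [comp_whiskerRight, Category.assoc, Category.assoc, associator_naturality_left,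
    ← Category.assoc, ← Category.assoc, ← Category.assoc]
  congr 1
  rw [Iso.comp_inv_eq, Category.assoc, this, Category.assoc, ← comp_whiskerRight_assoc]
  simp

lemma intertwines_associator₂ (a X c : C) {n : ℤ} (f : GrEnd X n) :
    Intertwines (α_ a X c).hom ((f.tensorLeft a).tensorRight c) ((f.tensorRight c).tensorLeft a) := by
  have := IsTensorTriangulated.associator_shift₂ a X c n
  unfold Intertwines tensorRight tensorLeft
  rw [comp_whiskerRight, MonoidalCategory.whiskerLeft_comp, Category.assoc, Category.assoc,
    associator_naturality_middle, ← Category.assoc, ← Category.assoc, ← Category.assoc,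
    ← Category.assoc]
  congr 1
  rw [← cancel_mono (a ◁ (shiftTensorRight X c n).hom ≫ (shiftTensorLeft a (X ⊗ c) n).hom)]
  simp only [Category.assoc]
  rw [this, ← comp_whiskerRight_assoc, ← MonoidalCategory.whiskerLeft_comp_assoc]
  simp

lemma intertwines_associator₃ (a b X : C) {n : ℤ} (f : GrEnd X n) :
    Intertwines (α_ a b X).hom (f.tensorLeft (a ⊗ b)) ((f.tensorLeft b).tensorLeft a) := by
  have := IsTensorTriangulated.associator_shift₃ a b X n
  unfold Intertwines tensorLeft
  rw [MonoidalCategory.whiskerLeft_comp, Category.assoc, associator_naturality_right,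
    ← Category.assoc, ← Category.assoc, ← Category.assoc]
  congr 1
  rw [← cancel_mono (a ◁ (shiftTensorLeft b X n).hom ≫ (shiftTensorLeft a (b ⊗ X) n).hom)]
  simp only [Category.assoc]
  rw [this, ← MonoidalCategory.whiskerLeft_comp_assoc]
  simp

/-- A graded endomorphism `f` of `X` is `⊗`-balanced if `f ⊗ X = X ⊗ f`. -/
def IsBalanced {X : C} {n : ℤ} (f : GrEnd X n) : Prop := f.tensorRight X = f.tensorLeft X

lemma IsBalanced.tensorRight {X : C} {n : ℤ} {f : GrEnd X n} (hf : f.IsBalanced) (Y : C) :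
    (f.tensorRight Y).IsBalanced := by
  have h := isIso_tensorμ X Y X Y
  refine Intertwines.eq (φ := tensorμ X Y X Y) (g := (f.tensorRight X).tensorRight (Y ⊗ Y)) ?_ ?_
  · exact (intertwines_associator₁ X Y (X ⊗ Y) f).comp <| (intertwines_whiskerLeft _ f).comp <|
      (intertwines_whiskerLeft _ f).comp <| (intertwines_whiskerLeft _ f).comp
        (Intertwines.inv (intertwines_associator₁ X X (Y ⊗ Y) f))
  · have hf' : f.tensorRight X = f.tensorLeft X := hf
    rw [hf']
    exact (intertwines_associator₃ X Y (X ⊗ Y) _).comp <|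
      ((intertwines_associator₂ Y X Y f).inv.whiskerLeft X).comp <|
      (((intertwines_braiding Y X f).whiskerRight Y).whiskerLeft X).comp <|
      ((intertwines_associator₁ X Y Y f).whiskerLeft X).comp
        (intertwines_associator₂ X X (Y ⊗ Y) f).inv

lemma IsBalanced.of_intertwines {X Y : C} {φ : X ≅ Y} {n : ℤ} {f : GrEnd X n} {g : GrEnd Y n}
    (h : Intertwines φ.hom f g) (hg : g.IsBalanced) : f.IsBalanced := by
  refine Intertwines.eq (φ := φ.hom ▷ X ≫ Y ◁ φ.hom) (g := g.tensorRight Y)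
    ((h.whiskerRight X).comp (intertwines_whiskerLeft φ.hom g)) ?_
  have hg' : g.tensorRight Y = g.tensorLeft Y := hg
  rw [hg', ← whisker_exchange]
  refine (h.whiskerLeft X).comp ?_
  unfold Intertwines tensorLeft
  rw [← cancel_epi (shiftTensorLeft X Y n).hom]
  have := NatTrans.shift_app_comm ((curriedTensor C).map φ.hom) n Y
  have e : (shiftTensorLeft X Y n).hom ≫ (φ.hom ▷ Y)⟦n⟧' =
    φ.hom ▷ Y⟦n⟧ ≫ (shiftTensorLeft Y Y n).hom := this
  rw [reassoc_of% e]
  simp [whisker_exchange]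

lemma IsBalanced.tensorLeft (a : C) {X : C} {n : ℤ} {f : GrEnd X n} (hf : f.IsBalanced) :
    (f.tensorLeft a).IsBalanced :=
  .of_intertwines (intertwines_braiding a X f) (hf.tensorRight a)

lemma tensorRight_mul {X : C} {m n : ℤ} (f : GrEnd X m) (g : GrEnd X n) (Y : C) :
    (f.mul g).tensorRight Y = (f.tensorRight Y).mul (g.tensorRight Y) := by
  have h := congr_app (congrArg Iso.inv
    ((CategoryTheory.MonoidalCategory.tensorRight Y).commShiftIso_add' (add_comm n m))) X
  have h' : (shiftTensorRight X Y (m + n)).inv =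
      (shiftFunctorAdd' C n m (m + n) (add_comm n m)).hom.app (X ⊗ Y) ≫
        (shiftTensorRight X Y n).inv⟦m⟧' ≫ (shiftTensorRight (X⟦n⟧) Y m).inv ≫
          (shiftFunctorAdd' C n m (m + n) (add_comm n m)).inv.app X ▷ Y := by
    refine h.trans ?_
    simp [shiftTensorRight]
  unfold tensorRight mul
  rw [h']
  simp only [comp_whiskerRight, Functor.map_comp, Category.assoc]
  rw [← comp_whiskerRight_assoc, Iso.inv_hom_id_app, id_whiskerRight, Category.id_comp,
    ← Category.assoc ((g ▷ Y)⟦m⟧'), shiftTensorRight_inv_natural, Category.assoc]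

lemma tensorLeft_mul {X : C} {m n : ℤ} (f : GrEnd X m) (g : GrEnd X n) (Y : C) :
    (f.mul g).tensorLeft Y = (f.tensorLeft Y).mul (g.tensorLeft Y) := by
  have h := congr_app (congrArg Iso.inv
    ((CategoryTheory.MonoidalCategory.tensorLeft Y).commShiftIso_add' (add_comm n m))) X
  have h' : (shiftTensorLeft Y X (m + n)).inv =
      (shiftFunctorAdd' C n m (m + n) (add_comm n m)).hom.app (Y ⊗ X) ≫
        (shiftTensorLeft Y X n).inv⟦m⟧' ≫ (shiftTensorLeft Y (X⟦n⟧) m).inv ≫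
          Y ◁ (shiftFunctorAdd' C n m (m + n) (add_comm n m)).inv.app X := by
    refine h.trans ?_
    simp [shiftTensorLeft]
  unfold tensorLeft mul
  rw [h']
  simp only [MonoidalCategory.whiskerLeft_comp, Functor.map_comp, Category.assoc]
  rw [← MonoidalCategory.whiskerLeft_comp_assoc Y, Iso.inv_hom_id_app]
  erw [MonoidalCategory.whiskerLeft_id]
  rw [Category.id_comp,
    ← Category.assoc ((Y ◁ g)⟦m⟧'), shiftTensorLeft_inv_natural, Category.assoc]

lemma IsBalanced.mul {X : C} {m n : ℤ} {f : GrEnd X m} {g : GrEnd X n} (hf : f.IsBalanced)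
    (hg : g.IsBalanced) : (f.mul g).IsBalanced := by
  have hf' : f.tensorRight X = f.tensorLeft X := hf
  have hg' : g.tensorRight X = g.tensorLeft X := hg
  unfold IsBalanced
  rw [tensorRight_mul, tensorLeft_mul, hf', hg']

/-- An endomorphism viewed as a graded endomorphism of degree `0`. -/
def ofEnd {X : C} (f : End X) : GrEnd X 0 := (shiftFunctorZero C ℤ).hom.app X ≫ f

lemma ofEnd_isBalanced {X : C} {f : End X} (hf : f ∈ balancedEnd X) : (ofEnd f).IsBalanced := by
  have hf' : f ▷ X = X ◁ f := hf
  have h₁ : (shiftTensorRight X X 0).inv =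
      (shiftFunctorZero C ℤ).hom.app (X ⊗ X) ≫ (shiftFunctorZero C ℤ).inv.app X ▷ X := by
    refine (congr_app (congrArg Iso.inv ((CategoryTheory.MonoidalCategory.tensorRight
      X).commShiftIso_zero ℤ)) X).trans ?_
    simp
  have h₂ : (shiftTensorLeft X X 0).inv =
      (shiftFunctorZero C ℤ).hom.app (X ⊗ X) ≫ X ◁ (shiftFunctorZero C ℤ).inv.app X := by
    refine (congr_app (congrArg Iso.inv ((CategoryTheory.MonoidalCategory.tensorLeft
      X).commShiftIso_zero ℤ)) X).trans ?_
    simp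
  unfold IsBalanced tensorRight tensorLeft ofEnd
  rw [h₁, h₂, Category.assoc, Category.assoc, ← comp_whiskerRight,
    ← MonoidalCategory.whiskerLeft_comp, Iso.inv_hom_id_app_assoc, hf']

end GrEnd

/-- The group `E_X^n` of `⊗`-balanced graded endomorphisms of `X` of degree `n`. -/
def GrBalanced (X : C) (n : ℤ) : AddSubgroup (GrEnd X n) where
  carrier := {f | f.IsBalanced}
  add_mem' {f g} hf hg := by
    change f.tensorRight X = f.tensorLeft X at hf
    change g.tensorRight X = g.tensorLeft X at hg
    change _ ≫ (tensorRight X).map (f + g) = _ ≫ (tensorLeft X).map (f + g)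
    rw [Functor.map_add, Functor.map_add, Preadditive.comp_add, Preadditive.comp_add]
    exact congrArg₂ (· + ·) hf hg
  zero_mem' := by
    change _ ≫ (tensorRight X).map 0 = _ ≫ (tensorLeft X).map 0
    rw [Functor.map_zero, Functor.map_zero, comp_zero, comp_zero]
  neg_mem' {f} hf := by
    change f.tensorRight X = f.tensorLeft X at hf
    change _ ≫ (tensorRight X).map (-f) = _ ≫ (tensorLeft X).map (-f)
    rw [Functor.map_neg, Functor.map_neg, Preadditive.comp_neg, Preadditive.comp_neg]
    exact congrArg (fun t => -t) hf

namespace GrBalanced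

/-- The graded product `E_X^m × E_X^n → E_X^(m+n)`. -/
def mul {X : C} {m n : ℤ} (f : GrBalanced X m) (g : GrBalanced X n) : GrBalanced X (m + n) :=
  ⟨GrEnd.mul f.1 g.1, GrEnd.IsBalanced.mul f.2 g.2⟩

/-- `f ↦ f ⊗ Y`, from `E_X^n` to `E_{X ⊗ Y}^n`. -/
def tensorRight {X : C} {n : ℤ} (f : GrBalanced X n) (Y : C) : GrBalanced (X ⊗ Y) n :=
  ⟨GrEnd.tensorRight f.1 Y, GrEnd.IsBalanced.tensorRight f.2 Y⟩

/-- `f ↦ a ⊗ f`, from `E_X^n` to `E_{a ⊗ X}^n`. -/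
def tensorLeft (a : C) {X : C} {n : ℤ} (f : GrBalanced X n) : GrBalanced (a ⊗ X) n :=
  ⟨GrEnd.tensorLeft a f.1, GrEnd.IsBalanced.tensorLeft a f.2⟩

/-- The inclusion of `E_X` as the degree zero part `E_X^0`. -/
def ofEnd {X : C} (f : balancedEnd X) : GrBalanced X 0 :=
  ⟨GrEnd.ofEnd f.1, GrEnd.ofEnd_isBalanced f.2⟩

end GrBalanced

end Graded

/-! ### The rings attached to a `⊗`-multiplicative family -/

section Family

variable {C : Type u} [Category.{v} C] [Preadditive C] [HasZeroObject C]
  [HasShift C ℤ] [∀ n : ℤ, (shiftFunctor C n).Additive] [Pretriangulated C] [IsTriangulated C]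
  [MonoidalCategory C] [SymmetricCategory C] [(curriedTensor C).CommShift₂Int]
  [IsTensorTriangulated C]

/-- Pairs `(X, f)` with `X ∈ Φ` and `f ∈ E_X`. -/
structure Rep (Φ : Set C) where
  obj : C
  mem : obj ∈ Φ
  map : balancedEnd obj

/-- The relations `(X, f) ∼ (a ⊗ X, a ⊗ f)` and `(X, f) ∼ (X ⊗ a, f ⊗ a)` for `a ∈ Φ`. -/
inductive Rep.Rel {Φ : Set C} : Rep Φ → Rep Φ → Prop
  | left (a X : C) (ha : a ∈ Φ) (hX : X ∈ Φ) (h : a ⊗ X ∈ Φ) (f : balancedEnd X) :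
      Rel ⟨X, hX, f⟩ ⟨a ⊗ X, h, balancedEnd.tensorLeft a f⟩
  | right (a X : C) (ha : a ∈ Φ) (hX : X ∈ Φ) (h : X ⊗ a ∈ Φ) (f : balancedEnd X) :
      Rel ⟨X, hX, f⟩ ⟨X ⊗ a, h, balancedEnd.tensorRight f a⟩

/-- The set underlying `R_Φ`: the quotient of the set of pairs `(X, f)` by the smallest
equivalence relation containing `Rep.Rel`. -/
def RingClass (Φ : Set C) : Type (max u v) := Quot (Rep.Rel (Φ := Φ))

/-- The class `[f_X]` in `R_Φ`. -/
def RingClass.mk {Φ : Set C} {X : C} (hX : X ∈ Φ) (f : balancedEnd X) : RingClass Φ :=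
  Quot.mk _ ⟨X, hX, f⟩

/-- Pairs `(X, f)` with `X ∈ Φ` and `f ∈ E_X^n`. -/
structure GrRep (Φ : Set C) (n : ℤ) where
  obj : C
  mem : obj ∈ Φ
  map : GrBalanced obj n

/-- The relations `(X, f) ∼ (a ⊗ X, a ⊗ f)` and `(X, f) ∼ (X ⊗ a, f ⊗ a)` for `a ∈ Φ`. -/
inductive GrRep.Rel {Φ : Set C} {n : ℤ} : GrRep Φ n → GrRep Φ n → Prop
  | left (a X : C) (ha : a ∈ Φ) (hX : X ∈ Φ) (h : a ⊗ X ∈ Φ) (f : GrBalanced X n) :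
      Rel ⟨X, hX, f⟩ ⟨a ⊗ X, h, GrBalanced.tensorLeft a f⟩
  | right (a X : C) (ha : a ∈ Φ) (hX : X ∈ Φ) (h : X ⊗ a ∈ Φ) (f : GrBalanced X n) :
      Rel ⟨X, hX, f⟩ ⟨X ⊗ a, h, GrBalanced.tensorRight f a⟩

/-- The set underlying `R_Φ^n`: the quotient of the set of pairs `(X, f)` by the smallest
equivalence relation containing `GrRep.Rel`, i.e. the colimit of the `E_X^n`, `X ∈ Φ`. -/
def GrRingClass (Φ : Set C) (n : ℤ) : Type (max u v) := Quot (GrRep.Rel (Φ := Φ) (n := n))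

/-- The class `[f_X]` in `R_Φ^n`. -/
def GrRingClass.mk {Φ : Set C} {X : C} (hX : X ∈ Φ) {n : ℤ} (f : GrBalanced X n) :
    GrRingClass Φ n :=
  Quot.mk _ ⟨X, hX, f⟩

/-- The ring structure on the set `R_Φ` has addition `[f_X] + [g_Y] = [f ⊗ Y + X ⊗ g]` and
multiplication `[f_X] [g_Y] = [(f ⊗ Y) ∘ (X ⊗ g)]`. -/
structure IsClassRing (Φ : Set C) (hΦ : ∀ a ∈ Φ, ∀ b ∈ Φ, a ⊗ b ∈ Φ)
    [CommRing (RingClass Φ)] : Prop where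
  add {X Y : C} (hX : X ∈ Φ) (hY : Y ∈ Φ) (f : balancedEnd X) (g : balancedEnd Y) :
    RingClass.mk hX f + RingClass.mk hY g =
      RingClass.mk (hΦ X hX Y hY) (balancedEnd.tensorRight f Y + balancedEnd.tensorLeft X g)
  mul {X Y : C} (hX : X ∈ Φ) (hY : Y ∈ Φ) (f : balancedEnd X) (g : balancedEnd Y) :
    RingClass.mk hX f * RingClass.mk hY g =
      RingClass.mk (hΦ X hX Y hY) (balancedEnd.tensorRight f Y * balancedEnd.tensorLeft X g)

/-- The graded ring `A = ⨁ 𝒜 n` is the graded ring `R_Φ^•`: its homogeneous components are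
identified with the sets `R_Φ^n` in such a way that `[f_X] + [g_Y] = [f ⊗ Y + X ⊗ g]` and
`[f_X] [g_Y] = [(f ⊗ Y) · (X ⊗ g)]`. These equations determine the graded ring. -/
structure IsClassGradedRing (Φ : Set C) (hΦ : ∀ a ∈ Φ, ∀ b ∈ Φ, a ⊗ b ∈ Φ)
    {A : Type (max u v)} [Ring A] (𝒜 : ℤ → AddSubgroup A) [GradedRing 𝒜]
    (κ : ∀ n, GrRingClass Φ n ≃ 𝒜 n) : Prop where
  add {n : ℤ} {X Y : C} (hX : X ∈ Φ) (hY : Y ∈ Φ) (f : GrBalanced X n) (g : GrBalanced Y n) :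
    (κ n (.mk hX f) : A) + κ n (.mk hY g) =
      κ n (.mk (hΦ X hX Y hY) (GrBalanced.tensorRight f Y + GrBalanced.tensorLeft X g))
  mul {m n : ℤ} {X Y : C} (hX : X ∈ Φ) (hY : Y ∈ Φ) (f : GrBalanced X m) (g : GrBalanced Y n) :
    (κ m (.mk hX f) : A) * κ n (.mk hY g) =
      κ (m + n) (.mk (hΦ X hX Y hY) (GrBalanced.mul (GrBalanced.tensorRight f Y) (GrBalanced.tensorLeft X g)))

end Family

/-! ### The homogeneous spectrum of a graded-commutative ring -/

section HomogeneousSpectrum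

variable {A : Type*} [Ring A] (𝒜 : ℤ → AddSubgroup A)

/-- `A` is graded-commutative: `a b = (-1)^(m n) b a` for `a` of degree `m` and `b` of
degree `n`. -/
def IsGradedCommutative : Prop :=
  ∀ (m n : ℤ) (a b : A), a ∈ 𝒜 m → b ∈ 𝒜 n → a * b = Int.negOnePow (m * n) • (b * a)

variable [GradedRing 𝒜]

/-- The homogeneous spectrum of a graded-commutative graded ring: the proper homogeneous ideals
`p` such that, for homogeneous `a` and `b`, `a b ∈ p` implies `a ∈ p` or `b ∈ p`. -/
@[ext]
structure HomogeneousSpectrum where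
  ideal : HomogeneousIdeal 𝒜
  twoSided : ideal.toIdeal.IsTwoSided
  ne_top : ideal.toIdeal ≠ ⊤
  mem_or_mem {a b : A} : SetLike.IsHomogeneousElem 𝒜 a → SetLike.IsHomogeneousElem 𝒜 b →
    a * b ∈ ideal.toIdeal → a ∈ ideal.toIdeal ∨ b ∈ ideal.toIdeal

/-- The Zariski topology: the closed sets are the sets of homogeneous primes containing a given
set of homogeneous elements. -/
instance : TopologicalSpace (HomogeneousSpectrum 𝒜) :=
  TopologicalSpace.generateFrom
    {U | ∃ a : A, SetLike.IsHomogeneousElem 𝒜 a ∧ U = {p | a ∉ p.ideal.toIdeal}}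

variable {𝒜}

/-- The map `p ↦ p ∩ A⁰`, where the degree zero part `A⁰` is identified with a commutative ring
`B` by means of an isomorphism `e`. -/
def HomogeneousSpectrum.degreeZero {B : Type*} [CommRing B] (e : B ≃+* 𝒜 0)
    (p : HomogeneousSpectrum 𝒜) : PrimeSpectrum B where
  asIdeal :=
    { carrier := {b | (e b : A) ∈ p.ideal.toIdeal}
      add_mem' := fun {a b} ha hb => by
        change ((e (a + b) : 𝒜 0) : A) ∈ p.ideal.toIdeal
        rw [map_add]
        exact add_mem ha hb
      zero_mem' := by
        change ((e 0 : 𝒜 0) : A) ∈ p.ideal.toIdeal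
        rw [map_zero]
        exact zero_mem _
      smul_mem' := fun c b hb => by
        change ((e (c * b) : 𝒜 0) : A) ∈ p.ideal.toIdeal
        rw [map_mul]
        exact Ideal.mul_mem_left _ _ hb }
  isPrime := by
    refine ⟨fun h => p.ne_top ?_, fun {a b} hab => ?_⟩
    · rw [Ideal.eq_top_iff_one] at h ⊢
      change ((e 1 : 𝒜 0) : A) ∈ p.ideal.toIdeal at h
      rwa [map_one] at h
    · change ((e (a * b) : 𝒜 0) : A) ∈ p.ideal.toIdeal at hab
      rw [map_mul] at hab
      exact p.mem_or_mem ⟨0, (e a).2⟩ ⟨0, (e b).2⟩ hab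

end HomogeneousSpectrum

end

end TensorTriangular

/-! Write "f is invertible at P" when the cone of f lies in P, that is, when f becomes an
isomorphism in the Verdier quotient by P. The graded comparison map sends P to the classes that are
not invertible at P, so the core of the theorem is that these form a homogeneous prime.

The ring. Classes of R_Φ^• can be moved to a common object X of Φ (`exists_rep₂`, `exists_rep₃`),
and there balancedness makes the class operations agree with the operations on E_X (`map₂_mk_same`).
The ring axioms are then identities of graded endomorphisms. Graded commutativity is the Koszul rule
for endomorphisms of different tensor factors, which comes from the anticommuting suspension
isomorphisms.

Primality. The key is `GrEnd.IsBalanced.exists_sq_zero`: for balanced f there is an object R, lying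
in the same primes as the cone of f, with f² ⊗ R = 0. If fg is invertible at P, then so is fg ⊗ R,
yet its square is zero because f and g commute up to sign. A zero morphism invertible at P forces X
⊗ R into P, and since P is prime and X is not in P, R lies in P; thus f is invertible at P. For f +
g one tensors with R ⊗ S, where S plays the same role for g, and uses (f + g)³ ⊗ (R ⊗ S) = 0.

Topology. Z_Φ and the homogeneous spectrum are both spectral because ultrafilters of primes have
limit primes (`IsSpectralSubbasis`). A map is then spectral as soon as it pulls a generating family
of opens back into such a subbasis; for the graded comparison map, the basic open set of [f] pulls
back to the primes containing cone(f).

Surjectivity onto the degree zero spectrum. A prime P of the degree zero part is the trace of the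
largest homogeneous ideal whose degree zero part lies in P, and graded commutativity makes that
ideal prime. -/

namespace TensorTriangular

/-! ### Spectral spaces from ultrafilter limits -/

section UltrafilterLimits

open TopologicalSpace Set

/-- A family of subsets `B` of a topological space is a *spectral subbasis* if it generates the
topology, and if every ultrafilter has a limit point for the topology in which all members of `B`
are both open and closed. -/
structure IsSpectralSubbasis {X ι : Type*} [t : TopologicalSpace X] (B : ι → Set X) : Prop where
  eq_generateFrom : t = generateFrom (range B)
  exists_limit (𝓤 : Ultrafilter X) : ∃ x, ∀ i, x ∈ B i ↔ B i ∈ 𝓤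

/-- Finite intersections of members of a family of sets. -/
def finiteInter {X ι : Type*} (B : ι → Set X) (s : Finset ι) : Set X := ⋂ i ∈ s, B i

lemma mem_finiteInter {X ι : Type*} {B : ι → Set X} {s : Finset ι} {x : X} :
    x ∈ finiteInter B s ↔ ∀ i ∈ s, x ∈ B i := by
  simp [finiteInter]

lemma isTopologicalBasis_finiteInter {X ι : Type*} [t : TopologicalSpace X] {B : ι → Set X}
    (h : t = generateFrom (range B)) : IsTopologicalBasis (range (finiteInter B)) := by
  classical
  convert isTopologicalBasis_of_subbasis h using 1
  ext U
  constructor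
  · rintro ⟨s, rfl⟩
    refine ⟨B '' s, ⟨s.finite_toSet.image B, image_subset_range _ _⟩, ?_⟩
    simp [finiteInter]
  · rintro ⟨f, ⟨hf, hfB⟩, rfl⟩
    choose g hg using hfB
    lift f to Finset (Set X) using hf
    refine ⟨f.attach.image fun U => g U.2, ?_⟩
    ext x
    simp only [mem_finiteInter, Finset.mem_image, Finset.mem_attach, true_and, mem_sInter]
    constructor
    · intro h U hU
      simpa [hg] using h _ ⟨⟨U, hU⟩, rfl⟩
    · rintro h _ ⟨⟨U, hU⟩, rfl⟩
      simpa [hg] using h U hU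

namespace IsSpectralSubbasis

variable {X ι : Type*} [t : TopologicalSpace X] {B : ι → Set X}

lemma isOpen (hB : IsSpectralSubbasis B) (i : ι) : IsOpen (B i) := by
  rw [hB.eq_generateFrom]
  exact isOpen_generateFrom_of_mem (mem_range_self i)

lemma le_nhds (hB : IsSpectralSubbasis B) {𝓤 : Ultrafilter X} {x : X}
    (hx : ∀ i, x ∈ B i ↔ B i ∈ 𝓤) : (𝓤 : Filter X) ≤ nhds x := by
  rw [hB.eq_generateFrom]
  refine (tendsto_nhds_generateFrom_iff (m := id)).2 ?_
  rintro _ ⟨i, rfl⟩ hi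
  exact (hx i).1 hi

/-- An ultrafilter containing the intersection contains each of its factors, so its limit point lies
in every factor. -/
lemma isCompact_finiteInter (hB : IsSpectralSubbasis B) (s : Finset ι) :
    IsCompact (finiteInter B s) := by
  rw [isCompact_iff_ultrafilter_le_nhds']
  intro 𝓤 h𝓤
  obtain ⟨x, hx⟩ := hB.exists_limit 𝓤
  refine ⟨x, mem_finiteInter.2 fun i hi => (hx i).2 ?_, hB.le_nhds hx⟩
  exact Filter.mem_of_superset h𝓤 fun y hy => mem_finiteInter.1 hy i hi

lemma isTopologicalBasis (hB : IsSpectralSubbasis B) :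
    IsTopologicalBasis (range (finiteInter B)) :=
  isTopologicalBasis_finiteInter hB.eq_generateFrom

/-- The generic point of S is the limit of an ultrafilter containing S and every open set that meets
S. Irreducibility is exactly the finite intersection property needed for such an ultrafilter to
exist. -/
lemma quasiSober (hB : IsSpectralSubbasis B) : QuasiSober X where
  sober {S} hS hS' := by
    classical
    obtain ⟨𝓤, h𝓤⟩ := Ultrafilter.exists_ultrafilter_of_finite_inter_nonempty
      (insert S {U | IsOpen U ∧ (S ∩ U).Nonempty}) (by
        intro T hT
        -- The set S need not be open, so it is removed from the finite family before irreducibility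
        -- is applied.
        obtain ⟨x, hxS, hx⟩ := isIrreducible_iff_sInter.1 hS (T.erase S)
          (fun U hU => by
            rcases hT (Finset.mem_of_mem_erase hU) with h | h
            · exact absurd h (Finset.ne_of_mem_erase hU)
            · exact h.1)
          (fun U hU => by
            rcases hT (Finset.mem_of_mem_erase hU) with h | h
            · exact absurd h (Finset.ne_of_mem_erase hU)
            · exact h.2)
        refine ⟨x, fun U hU => ?_⟩
        by_cases h : U = S
        · exact h ▸ hxS
        · exact hx U (by simpa using ⟨hU, h⟩))
    obtain ⟨x, hx⟩ := hB.exists_limit 𝓤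
    have hxS : x ∈ S := hS'.mem_of_frequently_of_tendsto (b := (𝓤 : Filter X)) (f := id)
      (Filter.Eventually.frequently (h𝓤 (mem_insert _ _))) (hB.le_nhds hx)
    refine ⟨x, Subset.antisymm (hS'.closure_subset_iff.2 (by simpa using hxS)) fun z hz => ?_⟩
    rw [hB.isTopologicalBasis.mem_closure_iff]
    rintro _ ⟨s, rfl⟩ hzs
    refine ⟨x, mem_finiteInter.2 fun i hi => (hx i).2 (h𝓤 ?_), rfl⟩
    exact mem_insert_of_mem _ ⟨hB.isOpen i, z, hz, mem_finiteInter.1 hzs i hi⟩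

lemma spectralSpace (hB : IsSpectralSubbasis B)
    (hsep : ∀ x y, (∀ i, x ∈ B i ↔ y ∈ B i) → x = y) : SpectralSpace X where
  __ := hB.quasiSober
  t0 x y h := hsep x y fun i => h.mem_open_iff (hB.isOpen i)
  isCompact_univ := by simpa [finiteInter] using hB.isCompact_finiteInter ∅
  __ := QuasiSeparatedSpace.of_isTopologicalBasis hB.isTopologicalBasis fun s s' => by
    classical
    convert hB.isCompact_finiteInter (s ∪ s') using 1
    ext x
    simp only [mem_inter_iff, mem_finiteInter, Finset.mem_union]
    grind
  __ := PrespectralSpace.of_isTopologicalBasis' hB.isTopologicalBasis hB.isCompact_finiteInter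

/-- A compact open set of the target is a finite union of finite intersections of generators, and
these pull back to finite intersections in the source, which are compact. Limits of ultrafilters are
needed in the source only. -/
lemma isSpectralMap (hB : IsSpectralSubbasis B) {Y κ : Type*} [t' : TopologicalSpace Y]
    {B' : κ → Set Y} (hB' : t' = generateFrom (range B')) {f : X → Y} {σ : κ → ι}
    (hf : ∀ j, f ⁻¹' B' j = B (σ j)) : IsSpectralMap f where
  toContinuous := by
    rw [hB', continuous_generateFrom_iff]
    rintro _ ⟨j, rfl⟩
    rw [hf]
    exact hB.isOpen _
  isCompact_preimage_of_isOpen K hK hK' := by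
    classical
    obtain ⟨s, hs, rfl⟩ := eq_finite_iUnion_of_isTopologicalBasis_of_isCompact_open _
      (isTopologicalBasis_finiteInter hB') K hK' hK
    rw [preimage_iUnion₂]
    refine hs.isCompact_biUnion fun r _ => ?_
    convert hB.isCompact_finiteInter (r.image σ) using 1
    ext x
    simp only [mem_preimage, mem_finiteInter, Finset.mem_image, forall_exists_index, and_imp,
      forall_apply_eq_imp_iff₂, ← hf]

end IsSpectralSubbasis

end UltrafilterLimits

/-! ### The homogeneous spectrum -/

namespace HomogeneousSpectrum

variable {A : Type*} [Ring A] {𝒜 : ℤ → AddSubgroup A} [GradedRing 𝒜]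

lemma one_notMem (p : HomogeneousSpectrum 𝒜) : (1 : A) ∉ p.ideal.toIdeal :=
  fun h => p.ne_top ((Ideal.eq_top_iff_one _).2 h)

lemma ext_homogeneous {p q : HomogeneousSpectrum 𝒜}
    (h : ∀ a, SetLike.IsHomogeneousElem 𝒜 a → (a ∈ p.ideal.toIdeal ↔ a ∈ q.ideal.toIdeal)) :
    p = q := by
  refine HomogeneousSpectrum.ext (HomogeneousIdeal.ext (Ideal.ext fun x => ?_))
  rw [p.ideal.isHomogeneous.mem_iff, q.ideal.isHomogeneous.mem_iff]
  exact forall_congr' fun n => h _ ⟨n, SetLike.coe_mem _⟩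

/-- A family of subsets of the homogeneous components having the closure properties of a
homogeneous prime ideal. -/
structure IsPrimeFamily (𝒜 : ℤ → AddSubgroup A) (S : ℤ → A → Prop) : Prop where
  zero (n : ℤ) : S n 0
  add {n : ℤ} {a b : A} : a ∈ 𝒜 n → b ∈ 𝒜 n → S n a → S n b → S n (a + b)
  mul_left {m n : ℤ} {a b : A} : a ∈ 𝒜 m → b ∈ 𝒜 n → S n b → S (m + n) (a * b)
  mul_right {m n : ℤ} {a b : A} : a ∈ 𝒜 m → b ∈ 𝒜 n → S m a → S (m + n) (a * b)
  one : ¬ S 0 1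
  mem_or_mem {m n : ℤ} {a b : A} : a ∈ 𝒜 m → b ∈ 𝒜 n → S (m + n) (a * b) → S m a ∨ S n b

/-- The homogeneous prime ideal with prescribed homogeneous components. -/
def ofFamily {S : ℤ → A → Prop} (hS : IsPrimeFamily 𝒜 S) : HomogeneousSpectrum 𝒜 :=
  let I : Ideal A :=
    { carrier := {x | ∀ n, S n (DirectSum.decompose 𝒜 x n)}
      add_mem' := fun {a b} ha hb n => by
        rw [DirectSum.decompose_add]
        exact hS.add (SetLike.coe_mem _) (SetLike.coe_mem _) (ha n) (hb n)
      zero_mem' := fun n => by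
        rw [DirectSum.decompose_zero]
        exact hS.zero n
      smul_mem' := fun c x hx n => by
        rw [smul_eq_mul]
        induction c using DirectSum.Decomposition.inductionOn 𝒜 with
        | zero => simpa using hS.zero n
        | @homogeneous i c =>
          obtain ⟨j, rfl⟩ : ∃ j, n = i + j := ⟨n - i, by ring⟩
          rw [DirectSum.coe_decompose_mul_add_of_left_mem 𝒜 c.2]
          exact hS.mul_left c.2 (SetLike.coe_mem _) (hx j)
        | add a b ha hb =>
          rw [add_mul, DirectSum.decompose_add]
          exact hS.add (SetLike.coe_mem _) (SetLike.coe_mem _) ha hb }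
  have hI : ∀ {x : A}, x ∈ I ↔ ∀ n, S n (DirectSum.decompose 𝒜 x n) := Iff.rfl
  have hI' : ∀ {n : ℤ} {a : A}, a ∈ 𝒜 n → (a ∈ I ↔ S n a) := fun {n a} ha => by
    rw [hI]
    refine ⟨fun h => by simpa [DirectSum.decompose_of_mem_same 𝒜 ha] using h n, fun h k => ?_⟩
    by_cases hk : n = k
    · subst hk
      rwa [DirectSum.decompose_of_mem_same 𝒜 ha]
    · rw [DirectSum.decompose_of_mem_ne 𝒜 ha hk]
      exact hS.zero k
  { ideal := ⟨I, fun n x hx => (hI' (SetLike.coe_mem _)).2 (hx n)⟩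
    twoSided := ⟨fun {x} c (hx : x ∈ I) => by
      change x * c ∈ I
      induction c using DirectSum.Decomposition.inductionOn 𝒜 with
      | zero => simp
      | @homogeneous i c =>
        intro n
        obtain ⟨j, rfl⟩ : ∃ j, n = j + i := ⟨n - i, by ring⟩
        rw [DirectSum.coe_decompose_mul_add_of_right_mem 𝒜 c.2]
        exact hS.mul_right (SetLike.coe_mem _) c.2 (hx j)
      | add a b ha hb =>
        rw [mul_add]
        exact add_mem ha hb⟩
    ne_top := fun h => hS.one <| (hI' (SetLike.one_mem_graded 𝒜)).1 <|
      (Ideal.eq_top_iff_one I).1 h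
    mem_or_mem := by
      rintro a b ⟨m, ha⟩ ⟨n, hb⟩ hab
      exact (hS.mem_or_mem ha hb ((hI' (SetLike.mul_mem_graded ha hb)).1 hab)).imp
        (hI' ha).2 (hI' hb).2 }

lemma mem_ofFamily {S : ℤ → A → Prop} (hS : IsPrimeFamily 𝒜 S) {n : ℤ} {a : A} (ha : a ∈ 𝒜 n) :
    a ∈ (ofFamily hS).ideal.toIdeal ↔ S n a := by
  change (∀ k, S k (DirectSum.decompose 𝒜 a k)) ↔ _
  refine ⟨fun h => by simpa [DirectSum.decompose_of_mem_same 𝒜 ha] using h n, fun h k => ?_⟩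
  by_cases hk : n = k
  · subst hk
    rwa [DirectSum.decompose_of_mem_same 𝒜 ha]
  · rw [DirectSum.decompose_of_mem_ne 𝒜 ha hk]
    exact hS.zero k

/-- The basic open subset of the homogeneous primes not containing a homogeneous element. -/
def basicOpen (𝒜 : ℤ → AddSubgroup A) [GradedRing 𝒜]
    (a : {a : A // SetLike.IsHomogeneousElem 𝒜 a}) : Set (HomogeneousSpectrum 𝒜) :=
  {p | a.1 ∉ p.ideal.toIdeal}

lemma eq_generateFrom_basicOpen (𝒜 : ℤ → AddSubgroup A) [GradedRing 𝒜] :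
    (inferInstance : TopologicalSpace (HomogeneousSpectrum 𝒜)) =
      TopologicalSpace.generateFrom (Set.range (basicOpen 𝒜)) := by
  change TopologicalSpace.generateFrom _ = _
  congr 1
  ext U
  constructor
  · rintro ⟨a, ha, rfl⟩
    exact ⟨⟨a, ha⟩, rfl⟩
  · rintro ⟨⟨a, ha⟩, rfl⟩
    exact ⟨a, ha, rfl⟩

/-- The homogeneous prime ideal which is the limit of an ultrafilter of homogeneous primes. -/
def limit (𝓤 : Ultrafilter (HomogeneousSpectrum 𝒜)) : HomogeneousSpectrum 𝒜 where
  ideal := ⟨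
    { carrier := {x | ∀ᶠ p : HomogeneousSpectrum 𝒜 in (𝓤 : Filter _), x ∈ p.ideal.toIdeal}
      add_mem' := fun ha hb => by
        filter_upwards [ha, hb] with p hpa hpb using add_mem hpa hpb
      zero_mem' := .of_forall fun p => zero_mem _
      smul_mem' := fun c x hx => by
        filter_upwards [hx] with p hp using Ideal.mul_mem_left _ _ hp },
    fun n x hx => by
      filter_upwards [hx] with p hp using p.ideal.isHomogeneous n hp⟩
  twoSided := ⟨fun {x} c hx => by
    filter_upwards [hx] with p hp
    have := p.twoSided
    exact Ideal.mul_mem_right _ _ hp⟩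
  ne_top h := by
    have h1 : ∀ᶠ p : HomogeneousSpectrum 𝒜 in (𝓤 : Filter _), (1 : A) ∈ p.ideal.toIdeal :=
      (Ideal.eq_top_iff_one _).1 h
    obtain ⟨p, hp⟩ := h1.exists
    exact p.one_notMem hp
  mem_or_mem {a b} ha hb hab := by
    -- This is where an ultrafilter, rather than a filter, is needed: a disjunction that holds
    -- eventually has a disjunct that holds eventually.
    refine Ultrafilter.eventually_or.1 ?_
    filter_upwards [hab] with p hp using p.mem_or_mem ha hb hp

lemma isSpectralSubbasis_basicOpen (𝒜 : ℤ → AddSubgroup A) [GradedRing 𝒜] :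
    IsSpectralSubbasis (basicOpen 𝒜) where
  eq_generateFrom := eq_generateFrom_basicOpen 𝒜
  exists_limit 𝓤 := ⟨limit 𝓤, fun a =>
    (Ultrafilter.eventually_not (f := 𝓤) (p := fun p => a.1 ∈ p.ideal.toIdeal)).symm⟩

instance : SpectralSpace (HomogeneousSpectrum 𝒜) :=
  (isSpectralSubbasis_basicOpen 𝒜).spectralSpace fun _ _ h => ext_homogeneous fun a ha =>
    not_iff_not.1 (h ⟨a, ha⟩)

/-! ### Restriction of homogeneous primes to degree zero -/

section DegreeZero

variable {B : Type*} [CommRing B] (e : B ≃+* 𝒜 0)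

lemma mem_degreeZero {p : HomogeneousSpectrum 𝒜} {b : B} :
    b ∈ (p.degreeZero e).asIdeal ↔ (e b : A) ∈ p.ideal.toIdeal :=
  Iff.rfl

lemma isSpectralMap_degreeZero : IsSpectralMap (degreeZero e) :=
  (isSpectralSubbasis_basicOpen 𝒜).isSpectralMap
    PrimeSpectrum.isTopologicalBasis_basic_opens.eq_generateFrom
    (σ := fun b => ⟨(e b : A), 0, (e b).2⟩) fun _ => rfl

lemma surjective_degreeZero (h𝒜 : IsGradedCommutative 𝒜) :
    Function.Surjective (degreeZero e) := by
  intro P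
  have unit_smul_mem (u : ℤˣ) (b : B) : u • b ∈ P.asIdeal ↔ b ∈ P.asIdeal := by
    rcases Int.units_eq_one_or u with rfl | rfl <;> simp [Units.smul_def]
  -- An element of degree n is put in the ideal when all its products of degree zero lie in P. This
  -- is the largest homogeneous ideal whose degree zero part is contained in P.
  let S : ℤ → A → Prop := fun n a =>
    ∀ b (c : B), b ∈ 𝒜 (-n) → (e c : A) = a * b → c ∈ P.asIdeal
  have exists_preimage {x : A} (hx : x ∈ 𝒜 0) : ∃ c, (e c : A) = x :=
    ⟨e.symm ⟨x, hx⟩, by simp⟩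
  have eq_of_coe {c d : B} (h : (e c : A) = e d) : c = d := e.injective (Subtype.ext h)
  have map_smul (u : ℤˣ) (c : B) : (e (u • c) : A) = u • (e c : A) := by
    rcases Int.units_eq_one_or u with rfl | rfl <;> simp [Units.smul_def]
  have mem_zero {n : ℤ} {a b : A} (ha : a ∈ 𝒜 n) (hb : b ∈ 𝒜 (-n)) : a * b ∈ 𝒜 0 := by
    simpa using SetLike.mul_mem_graded ha hb
  have hS : IsPrimeFamily 𝒜 S :=
    { zero := fun n b c hb hc => by
        have : c = 0 := eq_of_coe (by simpa using hc)
        exact this ▸ zero_mem _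
      add := fun {n a a'} ha ha' h h' b c hb hc => by
        obtain ⟨d, hd⟩ := exists_preimage (mem_zero ha hb)
        obtain ⟨d', hd'⟩ := exists_preimage (mem_zero ha' hb)
        have : c = d + d' := eq_of_coe (by simp [hc, hd, hd', add_mul])
        exact this ▸ add_mem (h b d hb hd) (h' b d' hb hd')
      -- Since (ab)d = ± b(da), the test of ab against d becomes the test of b against da; signs do
      -- not affect membership in P.
      mul_left := fun {m n a b} ha hb h d c hd hc => by
        have hbd : b * d ∈ 𝒜 (-m) := by
          simpa using SetLike.mul_mem_graded hb hd
        have hda : d * a ∈ 𝒜 (-n) := by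
          simpa using SetLike.mul_mem_graded hd ha
        rw [mul_assoc, h𝒜 _ _ _ _ ha hbd, mul_assoc] at hc
        obtain ⟨c', hc'⟩ := exists_preimage (mem_zero hb hda)
        have : c = Int.negOnePow (m * -m) • c' := eq_of_coe (by rw [map_smul, hc, hc'])
        rw [this, unit_smul_mem]
        exact h _ _ hda hc'
      mul_right := fun {m n a b} ha hb h d c hd hc => by
        have hbd : b * d ∈ 𝒜 (-m) := by
          simpa using SetLike.mul_mem_graded hb hd
        exact h _ _ hbd (by rw [hc, mul_assoc])
      one := fun h => P.2.one_notMem (h 1 1 (by simpa using SetLike.one_mem_graded 𝒜) (by simp))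
      mem_or_mem := fun {m n a b} ha hb h => by
        by_contra! hab
        simp only [S, not_forall] at hab
        obtain ⟨⟨a', c, ha', hc, hcP⟩, b', d, hb', hd, hdP⟩ := hab
        -- If aa' and bb' are outside P, then a'b' witnesses that ab is outside the ideal:
        -- (ab)(a'b') = ± (aa')(bb').
        refine (P.2.mul_notMem hcP hdP) ((unit_smul_mem (Int.negOnePow (n * -m)) _).1 ?_)
        refine h (a' * b') _ (by simpa [add_comm] using SetLike.mul_mem_graded ha' hb') ?_
        rw [map_smul, map_mul, SetLike.GradeZero.coe_mul, hc, hd, mul_assoc a b, ← mul_assoc b,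
          h𝒜 _ _ _ _ hb ha', smul_mul_assoc, mul_smul_comm]
        simp only [mul_assoc] }
  refine ⟨ofFamily hS, PrimeSpectrum.ext (Ideal.ext fun b => ?_)⟩
  rw [mem_degreeZero, mem_ofFamily hS (e b).2]
  refine ⟨fun h => h 1 b (by simpa using SetLike.one_mem_graded 𝒜) (by simp),
    fun h a c ha hc => ?_⟩
  obtain ⟨d, rfl⟩ := exists_preimage (by simpa using ha)
  have : c = b * d := eq_of_coe (by simpa using hc)
  exact this ▸ P.asIdeal.mul_mem_right _ h

end DegreeZero

end HomogeneousSpectrum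

/-! ### The limit of an ultrafilter of primes -/

section SpcLimit

variable {C : Type u} [Category.{v} C] [Preadditive C] [HasZeroObject C]
  [HasShift C ℤ] [∀ n : ℤ, (shiftFunctor C n).Additive] [Pretriangulated C]

namespace Spc

attribute [instance] Spc.isTriangulated Spc.thick

variable [MonoidalCategory C]

@[ext]
lemma ext {P Q : Spc C} (h : ∀ a, P.carrier a ↔ Q.carrier a) : P = Q := by
  have : P.carrier = Q.carrier := funext fun a => propext (h a)
  cases P
  cases Q
  simp_all

lemma unit_notMem (P : Spc C) [SymmetricCategory C] : ¬ P.carrier (𝟙_ C) := fun h => by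
  obtain ⟨a, ha⟩ := P.proper
  exact ha (P.carrier.prop_of_iso (ρ_ a) (P.tensor_mem a _ h))

lemma tensor_mem_left [SymmetricCategory C] (P : Spc C) {a : C} (b : C) (h : P.carrier a) :
    P.carrier (a ⊗ b) :=
  P.carrier.prop_of_iso (β_ b a) (P.tensor_mem b a h)

open Filter in
/-- The limit of an ultrafilter of primes. -/
def limit [SymmetricCategory C] (𝓤 : Ultrafilter (Spc C)) : Spc C where
  carrier a := ∀ᶠ P : Spc C in (𝓤 : Filter _), P.carrier a
  isTriangulated :=
    { exists_zero := ⟨_, isZero_zero C, .of_forall fun P => P.carrier.prop_zero⟩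
      isStableUnderShiftBy n := ⟨fun a (ha : ∀ᶠ P : Spc C in (𝓤 : Filter _), P.carrier a) => by
        change ∀ᶠ P : Spc C in (𝓤 : Filter _), P.carrier (a⟦n⟧)
        filter_upwards [ha] with P hP using P.carrier.le_shift n _ hP⟩
      ext₂' T hT h₁ h₃ := ObjectProperty.le_isoClosure _ _ (by
        filter_upwards [h₁, h₃] with P h₁ h₃
        exact P.carrier.ext_of_isTriangulatedClosed₂ T hT h₁ h₃) }
  thick := ⟨fun {a b} r hb => by
    filter_upwards [hb] with P hP using P.carrier.prop_of_retract r hP⟩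
  tensor_mem a b hb := by
    filter_upwards [hb] with P hP using P.tensor_mem a b hP
  proper := ⟨𝟙_ C, fun h => h.exists.elim fun P hP => P.unit_notMem hP⟩
  prime a b hab := by
    refine Ultrafilter.eventually_or.1 ?_
    filter_upwards [hab] with P hP using P.prime a b hP

/-- The trace on `Z_Φ` of the basic open subset of the primes containing a given object. -/
def basicOpen (Φ : Set C) (a : C) : Set (suppFamily Φ) := {P | P.1.carrier a}

lemma notMem_of_mem {Φ : Set C} (P : suppFamily Φ) {a : C} (ha : a ∈ Φ) : ¬ P.1.carrier a :=
  Set.mem_iInter₂.1 P.2 a ha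

/-- The limit prime stays in Z_Φ: an object of Φ in the limit would lie in some prime of Z_Φ, which
is excluded. -/
lemma isSpectralSubbasis_basicOpen [SymmetricCategory C] (Φ : Set C) :
    IsSpectralSubbasis (basicOpen Φ) where
  eq_generateFrom := by
    change TopologicalSpace.induced _ (TopologicalSpace.generateFrom _) = _
    rw [induced_generateFrom_eq]
    congr 1
    ext U
    constructor
    · rintro ⟨_, ⟨a, rfl⟩, rfl⟩
      exact ⟨a, by ext P; simp [basicOpen, supp]⟩
    · rintro ⟨a, rfl⟩
      exact ⟨_, ⟨a, rfl⟩, by ext P; simp [basicOpen, supp]⟩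
  exists_limit 𝓤 := by
    refine ⟨⟨limit (𝓤.map Subtype.val), ?_⟩, fun a => Iff.rfl⟩
    refine Set.mem_iInter₂.2 fun a ha h => ?_
    have h' : ∀ᶠ P : suppFamily Φ in (𝓤 : Filter _), P.1.carrier a := h
    obtain ⟨P, hP⟩ := h'.exists
    exact notMem_of_mem P ha hP

instance [SymmetricCategory C] (Φ : Set C) : SpectralSpace (suppFamily Φ) :=
  (isSpectralSubbasis_basicOpen Φ).spectralSpace fun _ _ h => Subtype.ext (Spc.ext h)

end Spc

end SpcLimit

/-! ### The calculus of graded endomorphisms -/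

section GradedEndomorphisms

variable {C : Type u} [Category.{v} C] [Preadditive C] [HasZeroObject C]
  [HasShift C ℤ] [∀ n : ℤ, (shiftFunctor C n).Additive] [Pretriangulated C] [IsTriangulated C]
  [MonoidalCategory C] [SymmetricCategory C] [(curriedTensor C).CommShift₂Int]
  [IsTensorTriangulated C]

/-- The source of all Koszul signs below: the anticommutation of the two suspension isomorphisms, in
bidegree (m, n). -/
lemma shiftTensor_comm (X Y : C) (m n : ℤ) :
    (shiftTensorLeft (X⟦m⟧) Y n).hom ≫ (shiftTensorRight X Y m).hom⟦n⟧' =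
      (m * n).negOnePow • ((shiftTensorRight X (Y⟦n⟧) m).hom ≫ (shiftTensorLeft X Y n).hom⟦m⟧' ≫
        (shiftComm (X ⊗ Y) m n).inv) := by
  refine ((curriedTensor C).commShift₂_comm .int X Y m n).trans ?_
  simp [shiftTensorLeft, shiftTensorRight]

lemma shiftTensor_comm_inv (X Y : C) (m n : ℤ) :
    (shiftTensorLeft X Y n).inv⟦m⟧' ≫ (shiftTensorRight X (Y⟦n⟧) m).inv =
      (m * n).negOnePow • ((shiftComm (X ⊗ Y) n m).hom ≫
        (shiftTensorRight X Y m).inv⟦n⟧' ≫ (shiftTensorLeft (X⟦m⟧) Y n).inv) := by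
  rw [← cancel_mono ((shiftTensorLeft (X⟦m⟧) Y n).hom ≫ (shiftTensorRight X Y m).hom⟦n⟧'),
    Linear.units_smul_comp]
  simp only [Category.assoc, Iso.inv_hom_id_assoc, ← Functor.map_comp, Iso.inv_hom_id]
  rw [shiftTensor_comm, Linear.comp_units_smul, Linear.comp_units_smul, Iso.inv_hom_id_assoc,
    ← Functor.map_comp_assoc, Iso.inv_hom_id, CategoryTheory.Functor.map_id,
    CategoryTheory.Functor.map_id, Category.id_comp, Category.comp_id,
    ← shiftComm_symm (X ⊗ Y) m n]
  rfl

lemma shiftTensorLeft_inv_natural' {X Y : C} (φ : X ⟶ Y) (Z : C) (n : ℤ) :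
    (φ ▷ Z)⟦n⟧' ≫ (shiftTensorLeft Y Z n).inv = (shiftTensorLeft X Z n).inv ≫ φ ▷ (Z⟦n⟧) := by
  rw [Iso.comp_inv_eq, Category.assoc, Iso.eq_inv_comp]
  exact NatTrans.shift_app_comm ((curriedTensor C).map φ) n Z

/-- Graded morphisms acting on different tensor factors commute up to the Koszul sign. -/
lemma whiskerLeft_whiskerRight_sign {X X' Y Y' : C} {m n : ℤ} (f : X⟦m⟧ ⟶ X') (g : Y⟦n⟧ ⟶ Y') :
    ((shiftTensorLeft X Y n).inv ≫ X ◁ g)⟦m⟧' ≫ (shiftTensorRight X Y' m).inv ≫ f ▷ Y' =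
      (m * n).negOnePow • ((shiftComm (X ⊗ Y) n m).hom ≫
        ((shiftTensorRight X Y m).inv ≫ f ▷ Y)⟦n⟧' ≫ (shiftTensorLeft X' Y n).inv ≫ X' ◁ g) := by
  rw [Functor.map_comp, Functor.map_comp, Category.assoc, Category.assoc,
    reassoc_of% (GrEnd.shiftTensorRight_inv_natural' X g m), whisker_exchange,
    reassoc_of% (shiftTensorLeft_inv_natural' f Y n),
    reassoc_of% (shiftTensor_comm_inv X Y m n)]
  simp [Linear.units_smul_comp]

namespace GrEnd

/-- The graded product with values in a prescribed degree. -/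
def mulOfEq {X : C} {m n k : ℤ} (f : GrEnd X m) (g : GrEnd X n) (h : m + n = k) : GrEnd X k :=
  (shiftFunctorAdd' C n m k (by rw [add_comm, h])).hom.app X ≫ g⟦m⟧' ≫ f

section

variable {X Y : C} {m n p k : ℤ}

/-- The intermediate degrees are free variables, so both bracketings live in the same group and no
transport along `add_assoc` occurs. -/
lemma mulOfEq_assoc (f : GrEnd X m) (g : GrEnd X n) (h : GrEnd X p) {mn np : ℤ}
    (hmn : m + n = mn) (hnp : n + p = np) (hk : m + n + p = k) :
    (f.mulOfEq g hmn).mulOfEq h (by rw [← hmn, hk]) =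
      f.mulOfEq (g.mulOfEq h hnp) (by rw [← hnp, ← add_assoc, hk]) := by
  have := shiftFunctorAdd'_assoc_hom_app p n m np mn k (by rw [← hnp, add_comm])
    (by rw [← hmn, add_comm]) (by rw [← hk]; ring) X
  simp only [mulOfEq, Functor.map_comp, Category.assoc]
  rw [reassoc_of% this]
  erw [← NatTrans.naturality_assoc]

lemma add_mulOfEq (f f' : GrEnd X m) (g : GrEnd X n) (h : m + n = k) :
    (f + f').mulOfEq g h = f.mulOfEq g h + f'.mulOfEq g h := by
  simp [mulOfEq]

lemma mulOfEq_add (f : GrEnd X m) (g g' : GrEnd X n) (h : m + n = k) :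
    f.mulOfEq (g + g') h = f.mulOfEq g h + f.mulOfEq g' h := by
  simp [mulOfEq, Functor.map_add]

lemma zero_mulOfEq (g : GrEnd X n) (h : m + n = k) : (0 : GrEnd X m).mulOfEq g h = 0 := by
  simp [mulOfEq]

lemma mulOfEq_zero (f : GrEnd X m) (h : m + n = k) : f.mulOfEq (0 : GrEnd X n) h = 0 := by
  simp [mulOfEq]

lemma units_smul_mulOfEq (u : ℤˣ) (f : GrEnd X m) (g : GrEnd X n) (h : m + n = k) :
    mulOfEq (u • f) g h = u • f.mulOfEq g h := by
  simp [mulOfEq, Linear.comp_units_smul]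

lemma mulOfEq_units_smul (u : ℤˣ) (f : GrEnd X m) (g : GrEnd X n) (h : m + n = k) :
    f.mulOfEq (u • g) h = u • f.mulOfEq g h := by
  rcases Int.units_eq_one_or u with rfl | rfl <;> simp [mulOfEq, Units.smul_def]

lemma ofEnd_mulOfEq (f : End X) (g : GrEnd X n) :
    (ofEnd f).mulOfEq g (zero_add n) = g ≫ f := by
  unfold mulOfEq ofEnd
  rw [shiftFunctorAdd'_add_zero_hom_app]
  erw [NatTrans.naturality_assoc]
  simp

lemma mulOfEq_ofEnd (f : GrEnd X n) (g : End X) :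
    f.mulOfEq (ofEnd g) (add_zero n) = g⟦n⟧' ≫ f := by
  unfold mulOfEq ofEnd
  rw [shiftFunctorAdd'_zero_add_hom_app, ← Functor.map_comp_assoc]
  simp

lemma ofEnd_mul (f g : End X) : ofEnd (f * g) = (ofEnd f).mulOfEq (ofEnd g) (zero_add 0) := by
  rw [ofEnd_mulOfEq]
  simp [ofEnd, End.mul_def]

lemma tensorRight_mulOfEq (f : GrEnd X m) (g : GrEnd X n) (h : m + n = k) (Z : C) :
    (f.mulOfEq g h).tensorRight Z = (f.tensorRight Z).mulOfEq (g.tensorRight Z) h := by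
  subst h
  exact tensorRight_mul f g Z

lemma tensorLeft_mulOfEq (f : GrEnd X m) (g : GrEnd X n) (h : m + n = k) (Z : C) :
    (f.mulOfEq g h).tensorLeft Z = (f.tensorLeft Z).mulOfEq (g.tensorLeft Z) h := by
  subst h
  exact tensorLeft_mul f g Z

lemma tensorRight_add (f g : GrEnd X n) (Z : C) :
    tensorRight (f + g) Z = f.tensorRight Z + g.tensorRight Z := by
  change _ ≫ (CategoryTheory.MonoidalCategory.tensorRight Z).map (f + g) = _
  rw [Functor.map_add, Preadditive.comp_add]
  rfl

lemma tensorLeft_add (f g : GrEnd X n) (Z : C) :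
    tensorLeft Z (f + g) = f.tensorLeft Z + g.tensorLeft Z := by
  change _ ≫ (CategoryTheory.MonoidalCategory.tensorLeft Z).map (f + g) = _
  rw [Functor.map_add, Preadditive.comp_add]
  rfl

lemma tensorRight_zero (Z : C) : tensorRight (0 : GrEnd X n) Z = 0 := by
  change _ ≫ (CategoryTheory.MonoidalCategory.tensorRight Z).map 0 = _
  rw [Functor.map_zero, comp_zero]

lemma tensorLeft_zero (Z : C) : tensorLeft Z (0 : GrEnd X n) = 0 := by
  change _ ≫ (CategoryTheory.MonoidalCategory.tensorLeft Z).map 0 = _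
  rw [Functor.map_zero, comp_zero]

lemma tensorLeft_neg (f : GrEnd X n) (Z : C) : tensorLeft Z (-f) = -f.tensorLeft Z := by
  change _ ≫ (CategoryTheory.MonoidalCategory.tensorLeft Z).map (-f) = _
  rw [Functor.map_neg, Preadditive.comp_neg]
  rfl

lemma tensorRight_neg (f : GrEnd X n) (Z : C) : tensorRight (-f) Z = -f.tensorRight Z := by
  change _ ≫ (CategoryTheory.MonoidalCategory.tensorRight Z).map (-f) = _
  rw [Functor.map_neg, Preadditive.comp_neg]
  rfl

lemma tensorRight_units_smul (u : ℤˣ) (f : GrEnd X n) (Z : C) :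
    tensorRight (u • f) Z = u • f.tensorRight Z := by
  rcases Int.units_eq_one_or u with rfl | rfl
  · simp
  · simp [Units.smul_def, tensorRight_neg]

lemma tensorRight_ofEnd (f : End X) (Z : C) : (ofEnd f).tensorRight Z = ofEnd (f ▷ Z) := by
  have h : (shiftTensorRight X Z 0).inv =
      (shiftFunctorZero C ℤ).hom.app (X ⊗ Z) ≫ (shiftFunctorZero C ℤ).inv.app X ▷ Z := by
    refine (congr_app (congrArg Iso.inv ((CategoryTheory.MonoidalCategory.tensorRight
      Z).commShiftIso_zero ℤ)) X).trans ?_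
    simp
  unfold tensorRight ofEnd
  rw [h, Category.assoc, ← comp_whiskerRight, Iso.inv_hom_id_app_assoc]

lemma tensorLeft_ofEnd (f : End X) (Z : C) : (ofEnd f).tensorLeft Z = ofEnd (Z ◁ f) := by
  have h : (shiftTensorLeft Z X 0).inv =
      (shiftFunctorZero C ℤ).hom.app (Z ⊗ X) ≫ Z ◁ (shiftFunctorZero C ℤ).inv.app X := by
    refine (congr_app (congrArg Iso.inv ((CategoryTheory.MonoidalCategory.tensorLeft
      Z).commShiftIso_zero ℤ)) X).trans ?_
    simp
  unfold tensorLeft ofEnd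
  rw [h, Category.assoc, ← MonoidalCategory.whiskerLeft_comp, Iso.inv_hom_id_app_assoc]

/-- Graded endomorphisms of different tensor factors commute up to the Koszul sign. -/
lemma tensorRight_mulOfEq_tensorLeft (f : GrEnd X m) (g : GrEnd Y n) (h : m + n = k) :
    (f.tensorRight Y).mulOfEq (g.tensorLeft X) h =
      (m * n).negOnePow • (g.tensorLeft X).mulOfEq (f.tensorRight Y) (by rw [add_comm, h]) := by
  have h' : n + m = k := by rw [add_comm, h]
  have e : (shiftComm (X ⊗ Y) n m).hom = (shiftFunctorAdd' C n m k h').inv.app (X ⊗ Y) ≫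
      (shiftFunctorAdd' C m n k h).hom.app (X ⊗ Y) :=
    congr_app (congrArg Iso.hom (shiftFunctorComm_eq C n m k h')) (X ⊗ Y)
  unfold mulOfEq tensorRight tensorLeft
  rw [whiskerLeft_whiskerRight_sign f g, Linear.comp_units_smul, e, Category.assoc,
    Iso.hom_inv_id_app_assoc]

lemma IsBalanced.mulOfEq {f : GrEnd X m} {g : GrEnd X n} (hf : f.IsBalanced)
    (hg : g.IsBalanced) (h : m + n = k) : (f.mulOfEq g h).IsBalanced := by
  subst h
  exact hf.mul hg

lemma Intertwines.mulOfEq {φ : X ⟶ Y} {f : GrEnd X m} {g : GrEnd X n} {f' : GrEnd Y m}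
    {g' : GrEnd Y n} (hf : Intertwines φ f f') (hg : Intertwines φ g g') (h : m + n = k) :
    Intertwines φ (f.mulOfEq g h) (f'.mulOfEq g' h) := by
  unfold Intertwines GrEnd.mulOfEq at *
  simp only [NatTrans.naturality_assoc, Functor.comp_map, Category.assoc]
  rw [← Functor.map_comp_assoc, hg, Functor.map_comp_assoc, hf]

lemma Intertwines.add {φ : X ⟶ Y} {f g : GrEnd X n} {f' g' : GrEnd Y n}
    (hf : Intertwines φ f f') (hg : Intertwines φ g g') : Intertwines φ (f + g) (f' + g') := by
  unfold Intertwines at *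
  simp [hf, hg]

lemma Intertwines.zero (φ : X ⟶ Y) : Intertwines φ (0 : GrEnd X n) (0 : GrEnd Y n) := by
  simp [Intertwines]

end

end GrEnd

end GradedEndomorphisms

/-! ### The graded ring of a multiplicative family -/

noncomputable section GradedRing

variable {C : Type u} [Category.{v} C] [Preadditive C] [HasZeroObject C]
  [HasShift C ℤ] [∀ n : ℤ, (shiftFunctor C n).Additive] [Pretriangulated C] [IsTriangulated C]
  [MonoidalCategory C] [SymmetricCategory C] [(curriedTensor C).CommShift₂Int]
  [IsTensorTriangulated C]

namespace GrEnd

lemma intertwines_whiskerRight {X Y Z : C} (φ : X ⟶ Y) {n : ℤ} (g : GrEnd Z n) :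
    Intertwines (φ ▷ Z) (g.tensorLeft X) (g.tensorLeft Y) := by
  unfold Intertwines tensorLeft
  rw [← Category.assoc, shiftTensorLeft_inv_natural', Category.assoc, Category.assoc,
    whisker_exchange]

lemma intertwines_braiding_inv (a X : C) {n : ℤ} (f : GrEnd X n) :
    Intertwines (β_ a X).symm.hom (f.tensorRight a) (f.tensorLeft a) :=
  (intertwines_braiding a X f).inv

/-- The isomorphism `X ⊗ (a ⊗ Y) ≅ a ⊗ (X ⊗ Y)`. -/
def leftComm (a X Y : C) : X ⊗ (a ⊗ Y) ≅ a ⊗ (X ⊗ Y) :=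
  (α_ X a Y).symm ≪≫ whiskerRightIso (β_ a X).symm Y ≪≫ α_ a X Y

lemma intertwines_leftComm_tensorRight (a X Y : C) {n : ℤ} (f : GrEnd X n) :
    Intertwines (leftComm a X Y).hom (f.tensorRight (a ⊗ Y)) ((f.tensorRight Y).tensorLeft a) :=
  (intertwines_associator₁ X a Y f).inv.comp <|
    ((intertwines_braiding_inv a X f).whiskerRight Y).comp (intertwines_associator₂ a X Y f)

lemma intertwines_leftComm_tensorLeft (a X Y : C) {n : ℤ} (g : GrEnd Y n) :
    Intertwines (leftComm a X Y).hom ((g.tensorLeft a).tensorLeft X)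
      ((g.tensorLeft X).tensorLeft a) :=
  (intertwines_associator₃ X a Y g).inv.comp <|
    (intertwines_whiskerRight _ g).comp (intertwines_associator₃ a X Y g)

end GrEnd

namespace GrBalanced

variable {X : C} {m n k : ℤ}

/-- The graded product with values in a prescribed degree. -/
def mulOfEq (f : GrBalanced X m) (g : GrBalanced X n) (h : m + n = k) : GrBalanced X k :=
  ⟨f.1.mulOfEq g.1 h, f.2.mulOfEq g.2 h⟩

lemma tensorRight_eq_tensorLeft (f : GrBalanced X n) : GrBalanced.tensorRight f X = GrBalanced.tensorLeft X f :=
  Subtype.ext f.2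

end GrBalanced

variable (C) in
/-- A non-empty family of objects which is closed under the tensor product. -/
structure TensorFamily where
  /-- the objects of the family -/
  carrier : Set C
  nonempty : carrier.Nonempty
  tensor_mem : ∀ a ∈ carrier, ∀ b ∈ carrier, a ⊗ b ∈ carrier

/-! ### Operations on classes and the ring axioms -/

namespace TensorFamily

variable (F : TensorFamily C)

/-- The homogeneous component of degree `n` of the graded ring of a multiplicative family. -/
abbrev Component (n : ℤ) : Type (max u v) := GrRingClass F.carrier n

variable {F} {n m k p : ℤ}

lemma mk_tensorLeft {a X : C} (ha : a ∈ F.carrier) (hX : X ∈ F.carrier) (f : GrBalanced X n) :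
    GrRingClass.mk (F.tensor_mem a ha X hX) (GrBalanced.tensorLeft a f) = GrRingClass.mk hX f :=
  (Quot.sound (.left a X ha hX _ f)).symm

lemma mk_tensorRight {a X : C} (ha : a ∈ F.carrier) (hX : X ∈ F.carrier) (f : GrBalanced X n) :
    GrRingClass.mk (F.tensor_mem X hX a ha) (GrBalanced.tensorRight f a) = GrRingClass.mk hX f :=
  (Quot.sound (.right a X ha hX _ f)).symm

/-- Graded endomorphisms which correspond to each other under an isomorphism have the same
class. -/
lemma mk_eq_of_intertwines {X Y : C} (hX : X ∈ F.carrier) (hY : Y ∈ F.carrier) (φ : X ≅ Y)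
    {f : GrBalanced X n} {g : GrBalanced Y n} (h : GrEnd.Intertwines φ.hom f.1 g.1) :
    GrRingClass.mk hX f = GrRingClass.mk hY g := by
  -- Both classes are represented on X ⊗ Y, by f ⊗ Y and X ⊗ g. The isomorphism φ ⊗ Y carries them
  -- to g ⊗ Y and Y ⊗ g, which agree because g is balanced.
  rw [← mk_tensorRight hY hX f, ← mk_tensorLeft hX hY g]
  congr 1
  have hg : g.1.tensorRight Y = g.1.tensorLeft Y := g.2
  exact Subtype.ext (GrEnd.Intertwines.eq (φ := φ.hom ▷ Y) (h.whiskerRight Y)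
    (hg ▸ GrEnd.intertwines_whiskerRight φ.hom g.1))

variable (C) in
/-- A binary operation on balanced graded endomorphisms, which is compatible with isomorphisms
and with tensor products. -/
structure NaturalOperation (m n k : ℤ) where
  /-- the operation -/
  op {X : C} : GrBalanced X m → GrBalanced X n → GrBalanced X k
  intertwines {X Y : C} (φ : X ≅ Y) {f : GrBalanced X m} {g : GrBalanced X n}
    {f' : GrBalanced Y m} {g' : GrBalanced Y n} :
    GrEnd.Intertwines φ.hom f.1 f'.1 → GrEnd.Intertwines φ.hom g.1 g'.1 →
      GrEnd.Intertwines φ.hom (op f g).1 (op f' g').1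
  tensorLeft (a : C) {X : C} (f : GrBalanced X m) (g : GrBalanced X n) :
    op (GrBalanced.tensorLeft a f) (GrBalanced.tensorLeft a g) = GrBalanced.tensorLeft a (op f g)

/-- The operation on classes `([f_X], [g_Y]) ↦ [op (f ⊗ Y) (X ⊗ g)]`. -/
def map₂ (T : NaturalOperation C m n k) : F.Component m → F.Component n → F.Component k :=
  -- Each of the four generating relations, two in each variable, inserts a factor a into X ⊗ Y; the
  -- symmetry moves a to the far left, where it does not change the class.
  have key {V W a : C} (hV : V ∈ F.carrier) (hW : W ∈ F.carrier) (ha : a ∈ F.carrier)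
      (φ : V ≅ a ⊗ W) {f : GrBalanced V m} {g : GrBalanced V n} {f' : GrBalanced W m}
      {g' : GrBalanced W n} (hf : GrEnd.Intertwines φ.hom f.1 (GrBalanced.tensorLeft a f').1)
      (hg : GrEnd.Intertwines φ.hom g.1 (GrBalanced.tensorLeft a g').1) :
      GrRingClass.mk hW (T.op f' g') = GrRingClass.mk hV (T.op f g) := by
    rw [← mk_tensorLeft ha hW, ← T.tensorLeft]
    exact (mk_eq_of_intertwines hV _ φ (T.intertwines φ hf hg)).symm
  Quot.lift₂
    (fun x y => GrRingClass.mk (F.tensor_mem _ x.mem _ y.mem)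
      (T.op (GrBalanced.tensorRight x.map y.obj) (GrBalanced.tensorLeft x.obj y.map)))
    (by
      rintro ⟨X, hX, f⟩ _ _ (⟨a, Y, ha, hY, h, g⟩ | ⟨a, Y, ha, hY, h, g⟩)
      · exact key _ _ ha (GrEnd.leftComm a X Y) (GrEnd.intertwines_leftComm_tensorRight a X Y f.1)
          (GrEnd.intertwines_leftComm_tensorLeft a X Y g.1)
      · exact key _ _ ha (whiskerLeftIso X (β_ a Y).symm ≪≫ GrEnd.leftComm a X Y)
          ((GrEnd.intertwines_whiskerLeft _ f.1).comp
            (GrEnd.intertwines_leftComm_tensorRight a X Y f.1))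
          (((GrEnd.intertwines_braiding_inv a Y g.1).whiskerLeft X).comp
            (GrEnd.intertwines_leftComm_tensorLeft a X Y g.1)))
    (by
      rintro _ _ ⟨Y, hY, g⟩ (⟨a, X, ha, hX, h, f⟩ | ⟨a, X, ha, hX, h, f⟩)
      · exact key _ _ ha (α_ a X Y) (GrEnd.intertwines_associator₂ a X Y f.1)
          (GrEnd.intertwines_associator₃ a X Y g.1)
      · exact key _ _ ha (whiskerRightIso (β_ a X).symm Y ≪≫ α_ a X Y)
          (((GrEnd.intertwines_braiding_inv a X f.1).whiskerRight Y).comp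
            (GrEnd.intertwines_associator₂ a X Y f.1))
          ((GrEnd.intertwines_whiskerRight _ g.1).comp
            (GrEnd.intertwines_associator₃ a X Y g.1)))

lemma map₂_mk (T : NaturalOperation C m n k) {X Y : C} (hX : X ∈ F.carrier) (hY : Y ∈ F.carrier)
    (f : GrBalanced X m) (g : GrBalanced Y n) :
    map₂ (F := F) T (.mk hX f) (.mk hY g) =
      .mk (F.tensor_mem X hX Y hY) (T.op (GrBalanced.tensorRight f Y) (GrBalanced.tensorLeft X g)) := rfl

/-- Balancedness gives f ⊗ X = X ⊗ f, so the result of the operation is X ⊗ op(f, g), equivalent to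
op(f, g). This reduces identities between classes to identities on one object. -/
lemma map₂_mk_same (T : NaturalOperation C m n k) {X : C} (hX : X ∈ F.carrier)
    (f : GrBalanced X m) (g : GrBalanced X n) :
    map₂ (F := F) T (.mk hX f) (.mk hX g) = .mk hX (T.op f g) := by
  rw [map₂_mk, GrBalanced.tensorRight_eq_tensorLeft f, T.tensorLeft, mk_tensorLeft hX hX]

/-- The addition of balanced graded endomorphisms. -/
def addOperation (n : ℤ) : NaturalOperation C n n n where
  op f g := f + g
  intertwines _ _ _ _ _ hf hg := hf.add hg
  tensorLeft a _ f g := Subtype.ext (GrEnd.tensorLeft_add f.1 g.1 a).symm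

/-- The product of balanced graded endomorphisms. -/
def mulOperation (h : m + n = k) : NaturalOperation C m n k where
  op f g := GrBalanced.mulOfEq f g h
  intertwines _ _ _ _ _ hf hg := hf.mulOfEq hg h
  tensorLeft a _ f g := Subtype.ext (GrEnd.tensorLeft_mulOfEq f.1 g.1 h a).symm

instance : Add (F.Component n) := ⟨map₂ (addOperation n)⟩

instance : Zero (F.Component n) := ⟨.mk F.nonempty.some_mem 0⟩

instance : Neg (F.Component n) := ⟨Quot.lift (fun x => .mk x.mem (-x.map)) (by
  rintro _ _ (⟨a, X, ha, hX, h, f⟩ | ⟨a, X, ha, hX, h, f⟩)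
  · rw [← mk_tensorLeft ha hX]
    exact congrArg (GrRingClass.mk h) (Subtype.ext (GrEnd.tensorLeft_neg f.1 a))
  · rw [← mk_tensorRight ha hX]
    exact congrArg (GrRingClass.mk h) (Subtype.ext (GrEnd.tensorRight_neg f.1 a)))⟩

lemma mk_add {X : C} (hX : X ∈ F.carrier) (f g : GrBalanced X n) :
    (GrRingClass.mk hX (f + g) : F.Component n) = .mk hX f + .mk hX g :=
  (map₂_mk_same (addOperation n) hX f g).symm

lemma mk_zero {X : C} (hX : X ∈ F.carrier) :
    (GrRingClass.mk hX 0 : F.Component n) = 0 := by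
  rw [← mk_tensorRight F.nonempty.some_mem hX]
  refine Eq.trans ?_ (mk_tensorLeft hX F.nonempty.some_mem 0)
  refine congrArg _ (Subtype.ext ?_)
  exact (GrEnd.tensorRight_zero _).trans (GrEnd.tensorLeft_zero _).symm

lemma mk_neg {X : C} (hX : X ∈ F.carrier) (f : GrBalanced X n) :
    (GrRingClass.mk hX (-f) : F.Component n) = -.mk hX f := rfl

lemma exists_rep (x : F.Component n) : ∃ (X : C) (hX : X ∈ F.carrier) (f : GrBalanced X n),
    x = .mk hX f := by
  obtain ⟨X, hX, f⟩ := x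
  exact ⟨X, hX, f, rfl⟩

lemma exists_rep₂ (x : F.Component m) (y : F.Component n) :
    ∃ (X : C) (hX : X ∈ F.carrier) (f : GrBalanced X m) (g : GrBalanced X n),
      x = .mk hX f ∧ y = .mk hX g := by
  obtain ⟨X, hX, f, rfl⟩ := exists_rep x
  obtain ⟨Y, hY, g, rfl⟩ := exists_rep y
  exact ⟨_, F.tensor_mem X hX Y hY, _, _, (mk_tensorRight hY hX f).symm,
    (mk_tensorLeft hX hY g).symm⟩

lemma exists_rep₃ (x : F.Component m) (y : F.Component n) (z : F.Component p) :
    ∃ (X : C) (hX : X ∈ F.carrier) (f : GrBalanced X m) (g : GrBalanced X n)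
      (h : GrBalanced X p), x = .mk hX f ∧ y = .mk hX g ∧ z = .mk hX h := by
  obtain ⟨X, hX, f, g, rfl, rfl⟩ := exists_rep₂ x y
  obtain ⟨Y, hY, h, rfl⟩ := exists_rep z
  exact ⟨_, F.tensor_mem X hX Y hY, _, _, _, (mk_tensorRight hY hX f).symm,
    (mk_tensorRight hY hX g).symm, (mk_tensorLeft hX hY h).symm⟩

instance : AddCommGroup (F.Component n) where
  add_assoc x y z := by
    obtain ⟨X, hX, f, g, h, rfl, rfl, rfl⟩ := exists_rep₃ x y z
    simp only [← mk_add, add_assoc]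
  zero_add x := by
    obtain ⟨X, hX, f, rfl⟩ := exists_rep x
    rw [← mk_zero hX, ← mk_add, zero_add]
  add_zero x := by
    obtain ⟨X, hX, f, rfl⟩ := exists_rep x
    rw [← mk_zero hX, ← mk_add, add_zero]
  nsmul := nsmulRec
  zsmul := zsmulRec
  neg_add_cancel x := by
    obtain ⟨X, hX, f, rfl⟩ := exists_rep x
    rw [← mk_neg, ← mk_add, neg_add_cancel, mk_zero]
  add_comm x y := by
    obtain ⟨X, hX, f, g, rfl, rfl⟩ := exists_rep₂ x y
    rw [← mk_add, ← mk_add, add_comm]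

/-- The product of classes, with values in a prescribed degree. -/
def mulOfEq (h : m + n = k) : F.Component m → F.Component n → F.Component k :=
  map₂ (mulOperation h)

lemma mulOfEq_mk (h : m + n = k) {X Y : C} (hX : X ∈ F.carrier) (hY : Y ∈ F.carrier)
    (f : GrBalanced X m) (g : GrBalanced Y n) :
    mulOfEq (F := F) h (.mk hX f) (.mk hY g) =
      .mk (F.tensor_mem X hX Y hY) (GrBalanced.mulOfEq (GrBalanced.tensorRight f Y) (GrBalanced.tensorLeft X g) h) := rfl

lemma mulOfEq_mk_same (h : m + n = k) {X : C} (hX : X ∈ F.carrier)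
    (f : GrBalanced X m) (g : GrBalanced X n) :
    mulOfEq (F := F) h (.mk hX f) (.mk hX g) = .mk hX (GrBalanced.mulOfEq f g h) :=
  map₂_mk_same (mulOperation h) hX f g

lemma mulOfEq_assoc {mn np : ℤ} (x : F.Component m) (y : F.Component n) (z : F.Component p)
    (hmn : m + n = mn) (hnp : n + p = np) (hk : m + n + p = k) :
    mulOfEq (by rw [← hmn, hk]) (mulOfEq hmn x y) z =
      mulOfEq (k := k) (by rw [← hnp, ← add_assoc, hk]) x (mulOfEq hnp y z) := by
  obtain ⟨X, hX, f, g, h, rfl, rfl, rfl⟩ := exists_rep₃ x y z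
  simp only [mulOfEq_mk_same]
  exact congrArg _ (Subtype.ext (GrEnd.mulOfEq_assoc f.1 g.1 h.1 hmn hnp hk))

/-- The comparison is made on X ⊗ X: balancedness rewrites both products in terms of f ⊗ X and X ⊗
g, which act on different factors and satisfy the Koszul rule. -/
lemma mulOfEq_comm (x : F.Component m) (y : F.Component n) (h : m + n = k) :
    mulOfEq h x y = (m * n).negOnePow • mulOfEq (by rw [add_comm, h]) y x := by
  obtain ⟨X, hX, f, g, rfl, rfl⟩ := exists_rep₂ x y
  rw [mulOfEq_mk, mulOfEq_mk, ← GrBalanced.tensorRight_eq_tensorLeft f, GrBalanced.tensorRight_eq_tensorLeft g]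
  have key : GrBalanced.mulOfEq (GrBalanced.tensorRight f X) (GrBalanced.tensorLeft X g) h =
      (m * n).negOnePow • GrBalanced.mulOfEq (GrBalanced.tensorLeft X g) (GrBalanced.tensorRight f X) (by rw [add_comm, h]) :=
    Subtype.ext (GrEnd.tensorRight_mulOfEq_tensorLeft f.1 g.1 h)
  rw [key]
  rcases Int.units_eq_one_or (m * n).negOnePow with h | h <;> simp [h, Units.smul_def, mk_neg]

lemma mulOfEq_add (h : m + n = k) (x : F.Component m) (y z : F.Component n) :
    mulOfEq h x (y + z) = mulOfEq h x y + mulOfEq h x z := by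
  obtain ⟨X, hX, f, g, g', rfl, rfl, rfl⟩ := exists_rep₃ x y z
  simp only [← mk_add, mulOfEq_mk_same]
  exact congrArg _ (Subtype.ext (GrEnd.mulOfEq_add f.1 g.1 g'.1 h))

lemma add_mulOfEq (h : m + n = k) (x y : F.Component m) (z : F.Component n) :
    mulOfEq h (x + y) z = mulOfEq h x z + mulOfEq h y z := by
  obtain ⟨X, hX, f, g, g', rfl, rfl, rfl⟩ := exists_rep₃ x y z
  simp only [← mk_add, mulOfEq_mk_same]
  exact congrArg _ (Subtype.ext (GrEnd.add_mulOfEq f.1 g.1 g'.1 h))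

lemma mulOfEq_zero (h : m + n = k) (x : F.Component m) :
    mulOfEq h x (0 : F.Component n) = 0 := by
  simpa using mulOfEq_add h x 0 0

lemma zero_mulOfEq (h : m + n = k) (x : F.Component n) :
    mulOfEq h (0 : F.Component m) x = 0 := by
  simpa using add_mulOfEq h 0 0 x

instance : One (F.Component 0) := ⟨.mk F.nonempty.some_mem (GrBalanced.ofEnd 1)⟩

lemma mk_one {X : C} (hX : X ∈ F.carrier) :
    (GrRingClass.mk hX (GrBalanced.ofEnd 1) : F.Component 0) = 1 := by
  rw [← mk_tensorRight F.nonempty.some_mem hX]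
  refine Eq.trans ?_ (mk_tensorLeft hX F.nonempty.some_mem (GrBalanced.ofEnd 1))
  refine congrArg _ (Subtype.ext ?_)
  refine (GrEnd.tensorRight_ofEnd _ _).trans (Eq.trans ?_ (GrEnd.tensorLeft_ofEnd _ _).symm)
  refine congrArg GrEnd.ofEnd ?_
  exact (id_whiskerRight _ _).trans (MonoidalCategory.whiskerLeft_id _ _).symm

lemma one_mulOfEq (x : F.Component n) : mulOfEq (zero_add n) 1 x = x := by
  obtain ⟨X, hX, f, rfl⟩ := exists_rep x
  rw [← mk_one hX, mulOfEq_mk_same]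
  exact congrArg _ (Subtype.ext ((GrEnd.ofEnd_mulOfEq _ f.1).trans (Category.comp_id _)))

lemma mulOfEq_one (x : F.Component n) : mulOfEq (add_zero n) x 1 = x := by
  obtain ⟨X, hX, f, rfl⟩ := exists_rep x
  rw [← mk_one hX, mulOfEq_mk_same]
  refine congrArg _ (Subtype.ext ((GrEnd.mulOfEq_ofEnd f.1 _).trans ?_))
  refine (congrArg (· ≫ f.1) (CategoryTheory.Functor.map_id _ _)).trans (Category.id_comp _)

end TensorFamily

end GradedRing

/-! ### Graded endomorphisms whose cone belongs to a prime -/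

section ConeInPrime

variable {C : Type u} [Category.{v} C] [Preadditive C] [HasZeroObject C]
  [HasShift C ℤ] [∀ n : ℤ, (shiftFunctor C n).Additive] [Pretriangulated C] [IsTriangulated C]
  [MonoidalCategory C] [SymmetricCategory C] [(curriedTensor C).CommShift₂Int]
  [IsTensorTriangulated C]

namespace Spc

variable (P : Spc C)

/-- Replaces the chosen cone by the class `trW` of morphisms some, equivalently any, cone of which
lies in P; that class is stable under composition, shifts and isomorphisms. -/
lemma carrier_cone_iff {X Y : C} (f : X ⟶ Y) : P.carrier (cone f) ↔ P.carrier.trW f := by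
  obtain ⟨g, h, hT⟩ := (distinguished_cocone_triangle f).choose_spec
  exact (P.carrier.trW_iff_of_distinguished _ hT).symm

variable {P}

lemma trW_whiskerRight {X Y : C} {f : X ⟶ Y} (hf : P.carrier.trW f) (Z : C) :
    P.carrier.trW (f ▷ Z) := by
  obtain ⟨W, g, h, hT, hW⟩ := hf
  exact ObjectProperty.trW.mk _ ((tensorRight Z).map_distinguished _ hT) (P.tensor_mem_left Z hW)

/-- By exactness cone(f) ⊗ Z is a cone of f ⊗ Z, and primality removes the factor Z. This makes the
condition on cones independent of the representative. -/
lemma trW_whiskerRight_iff {X Y Z : C} {f : X ⟶ Y} (hZ : ¬ P.carrier Z) :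
    P.carrier.trW (f ▷ Z) ↔ P.carrier.trW f := by
  refine ⟨fun h => ?_, fun h => trW_whiskerRight h Z⟩
  obtain ⟨W, a, b, hT⟩ := distinguished_cocone_triangle f
  have := (P.carrier.trW_iff_of_distinguished _ ((tensorRight Z).map_distinguished _ hT)).1 h
  exact ⟨W, a, b, hT, (P.prime _ _ this).resolve_right hZ⟩

lemma trW_whiskerLeft_iff {X Y Z : C} {f : X ⟶ Y} (hZ : ¬ P.carrier Z) :
    P.carrier.trW (Z ◁ f) ↔ P.carrier.trW f := by
  rw [← trW_whiskerRight_iff (f := f) hZ]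
  exact P.carrier.trW.arrow_mk_iso_iff (Arrow.isoMk (β_ _ _) (β_ _ _))

/-- The identity of Y is killed by precomposition with zero, so it factors through the cone and Y is
a retract of it. -/
lemma carrier_of_trW_zero {X Y : C} (h : P.carrier.trW (0 : X ⟶ Y)) : P.carrier Y := by
  obtain ⟨Z, a, b, hT, hZ⟩ := h
  obtain ⟨s, hs⟩ := Triangle.yoneda_exact₂ _ hT (𝟙 Y) zero_comp
  exact P.carrier.prop_of_retract ⟨a, s, hs.symm⟩ hZ

section

variable {X Z : C} {m n k : ℤ}

lemma trW_tensorRight {f : GrEnd X n} (hf : P.carrier.trW f) (Z : C) :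
    P.carrier.trW (f.tensorRight Z) :=
  (P.carrier.trW.cancel_left_of_respectsIso _ _).2 (trW_whiskerRight hf Z)

lemma trW_tensorRight_iff {f : GrEnd X n} (hZ : ¬ P.carrier Z) :
    P.carrier.trW (f.tensorRight Z) ↔ P.carrier.trW f :=
  (P.carrier.trW.cancel_left_of_respectsIso _ _).trans (trW_whiskerRight_iff hZ)

lemma trW_tensorLeft_iff {f : GrEnd X n} (hZ : ¬ P.carrier Z) :
    P.carrier.trW (f.tensorLeft Z) ↔ P.carrier.trW f :=
  (P.carrier.trW.cancel_left_of_respectsIso _ _).trans (trW_whiskerLeft_iff hZ)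

lemma trW_ofEnd_iff {f : End X} : P.carrier.trW (GrEnd.ofEnd f) ↔ P.carrier.trW (X := X) f :=
  P.carrier.trW.cancel_left_of_respectsIso _ _

lemma trW_mulOfEq {f : GrEnd X m} {g : GrEnd X n} (hf : P.carrier.trW f) (hg : P.carrier.trW g)
    (h : m + n = k) : P.carrier.trW (f.mulOfEq g h) :=
  (P.carrier.trW.cancel_left_of_respectsIso _ _).2
    (P.carrier.trW.comp_mem _ _ (hg.shift m) hf)

end

end Spc

/-! ### Nilpotence of a balanced endomorphism on its cone -/

namespace GrEnd

variable {X : C} {m n k : ℤ}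

/-- The action of `f` on `X ⊗ Zᵏ`, for a shifted object `Zᵏ`. -/
lemma tensorRight_shift (f : GrEnd X n) (Z : C) (k : ℤ) :
    (shiftTensorLeft X Z k).inv⟦n⟧' ≫ f.tensorRight (Z⟦k⟧) =
      (n * k).negOnePow • ((shiftComm (X ⊗ Z) k n).hom ≫ (f.tensorRight Z)⟦k⟧' ≫
        (shiftTensorLeft X Z k).inv) := by
  have := whiskerLeft_whiskerRight_sign f (𝟙 (Z⟦k⟧))
  rw [MonoidalCategory.whiskerLeft_id, Category.comp_id] at this
  exact this

/-- A balanced graded endomorphism acts with square zero on an object which belongs to the same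
primes as its cone. -/
lemma IsBalanced.exists_sq_zero {f : GrEnd X n} (hf : f.IsBalanced) :
    ∃ R : C, (∀ P : Spc C, P.carrier.trW f ↔ P.carrier R) ∧
      ((f.mulOfEq f rfl).tensorRight R) = 0 := by
  -- Desuspending f to f' : X ⟶ Σ⁻ⁿX lets its fibre R be taken with a map d into X itself. Up to a
  -- shift, R is a cone of f.
  let Y : C := X⟦-n⟧
  let θ : Y⟦n⟧ ≅ X := (shiftFunctorCompIsoId C (-n) n (neg_add_cancel n)).app X
  obtain ⟨f', hf'⟩ := (shiftFunctor C n).map_surjective (f ≫ θ.inv : X⟦n⟧ ⟶ Y⟦n⟧)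
  obtain ⟨R, d, e, hT⟩ := distinguished_cocone_triangle₁ f'
  refine ⟨R, fun P => ?_, ?_⟩
  · rw [← P.carrier.trW.cancel_right_of_respectsIso f θ.inv, ← hf']
    exact ⟨fun h => (P.carrier.trW_iff_of_distinguished' _ hT).1 h.unshift,
      fun h => ((P.carrier.trW_iff_of_distinguished' _ hT).2 h).shift n⟩
  have hf₁ : f.tensorRight X = (shiftTensorLeft X X n).inv ≫ X ◁ f := hf
  have hdf : d⟦n⟧' ≫ f = 0 := by
    rw [← cancel_mono θ.inv, Category.assoc, ← hf', ← Functor.map_comp,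
      show d ≫ f' = 0 from comp_distTriang_mor_zero₁₂ _ hT, Functor.map_zero, zero_comp]
  have hfe : f ≫ θ.inv ≫ e⟦n⟧' = 0 := by
    rw [← Category.assoc, ← hf', ← Functor.map_comp,
      show f' ≫ e = 0 from comp_distTriang_mor_zero₂₃ _ hT, Functor.map_zero]
  -- By naturality this composite is the shift of X ⊗ d followed by f ⊗ X. Balancedness replaces f ⊗
  -- X by X ⊗ f, and f vanishes after the shift of d.
  have h₁ : f.tensorRight R ≫ X ◁ d = 0 := by
    have := intertwines_whiskerLeft (X := X) d f
    unfold Intertwines at this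
    rw [← this, hf₁, reassoc_of% (shiftTensorLeft_inv_natural d X n),
      ← MonoidalCategory.whiskerLeft_comp, hdf]
    exact (congrArg _ ((MonoidalCategory.tensorLeft X).map_zero _ _)).trans comp_zero
  have h₂ : f.tensorRight (Y⟦n⟧) ≫ X ◁ (e⟦n⟧') = 0 := by
    have := intertwines_whiskerLeft (X := X) θ.inv f
    unfold Intertwines at this
    have hθ : IsIso ((X ◁ θ.inv)⟦n⟧') := inferInstance
    rw [← cancel_epi ((X ◁ θ.inv)⟦n⟧'), reassoc_of% this, hf₁, Category.assoc,
      ← MonoidalCategory.whiskerLeft_comp, ← MonoidalCategory.whiskerLeft_comp, hfe, comp_zero]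
    exact (congrArg _ ((MonoidalCategory.tensorLeft X).map_zero _ _)).trans comp_zero
  -- The previous vanishing is desuspended n times; the Koszul sign is a unit and drops out.
  have h₃ : f.tensorRight Y ≫ X ◁ e = 0 := by
    have := tensorRight_shift f Y n =≫ X ◁ (e⟦n⟧')
    rw [Category.assoc, h₂, comp_zero, Linear.units_smul_comp, eq_comm, smul_eq_zero_iff_eq,
      Category.assoc, Category.assoc, ← shiftTensorLeft_inv_natural e X n,
      Preadditive.IsIso.comp_left_eq_zero, ← Category.assoc, Preadditive.IsIso.comp_right_eq_zero,
      ← Functor.map_comp] at this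
    exact (shiftFunctor C n).map_injective (this.trans (Functor.map_zero _ _ _).symm)
  have hT' : Triangle.mk (X ◁ d) (X ◁ f') (X ◁ e ≫ (shiftTensorLeft X R 1).hom) ∈
      distTriang C := (MonoidalCategory.tensorLeft X).map_distinguished _ hT
  have h₄ : (X ◁ e ≫ (shiftTensorLeft X R 1).hom)⟦n⟧' ≫
      (shiftComm (X ⊗ R) 1 n).hom ≫ (f.tensorRight R)⟦(1 : ℤ)⟧' = 0 := by
    have h := (X ◁ e ≫ (shiftTensorLeft X R 1).hom)⟦n⟧' ≫= tensorRight_shift f R 1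
    have h' := intertwines_whiskerLeft (X := X) e f
    unfold Intertwines at h'
    rw [← Functor.map_comp_assoc, Category.assoc, Iso.hom_inv_id, Category.comp_id, h', h₃,
      Linear.comp_units_smul, eq_comm, smul_eq_zero_iff_eq, ← Category.assoc, ← Category.assoc,
      Preadditive.IsIso.comp_right_eq_zero, Category.assoc] at h
    exact h
  -- After one suspension, f ⊗ R kills the connecting map of the triangle tensored with X, hence
  -- factors through the shift of X ⊗ d. The other copy of f ⊗ R is killed by X ⊗ d by `h₁`, so the
  -- square vanishes.
  obtain ⟨s, hs⟩ : ∃ s, (f.tensorRight R)⟦(1 : ℤ)⟧' = (X ◁ d)⟦n⟧'⟦(1 : ℤ)⟧' ≫ s := by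
    let η := (shiftFunctorCompIsoId C (-n) n (neg_add_cancel n)).app ((X ⊗ R)⟦(1 : ℤ)⟧)
    obtain ⟨G, hG⟩ := (shiftFunctor C n).map_surjective
      ((shiftComm (X ⊗ R) 1 n).hom ≫ (f.tensorRight R)⟦(1 : ℤ)⟧' ≫ η.inv)
    have hG' : (X ◁ e ≫ (shiftTensorLeft X R 1).hom) ≫ G = 0 := by
      apply (shiftFunctor C n).map_injective
      rw [Functor.map_comp, hG, Functor.map_zero, ← Category.assoc, ← Category.assoc,
        Preadditive.IsIso.comp_right_eq_zero, Category.assoc, h₄]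
    obtain ⟨t, ht⟩ : ∃ t, G = (X ◁ d)⟦(1 : ℤ)⟧' ≫ t := by
      obtain ⟨t, ht⟩ := Triangle.yoneda_exact₃ _ (rot_of_distTriang _ hT') G hG'
      -- Rotating the triangle introduces a sign on the shift of X ⊗ d, absorbed into t.
      exact ⟨-t, ht.trans ((Preadditive.neg_comp _ _).trans (Preadditive.comp_neg _ _).symm)⟩
    refine ⟨(shiftComm (X ⊗ X) n 1).hom ≫ t⟦n⟧' ≫ η.hom, ?_⟩
    rw [← reassoc_of% (shiftComm_hom_comp (f := X ◁ d) n 1), ← Functor.map_comp_assoc, ← ht, hG,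
      ← shiftComm_symm (X ⊗ R) 1 n]
    simp only [Category.assoc, Iso.symm_hom, Iso.inv_hom_id_assoc, Iso.inv_hom_id]
    exact (Category.comp_id _).symm
  rw [tensorRight_mulOfEq]
  apply (shiftFunctor C (1 : ℤ)).map_injective
  rw [GrEnd.mulOfEq, ← Category.assoc, Functor.map_comp, hs, ← Functor.map_comp_assoc,
    Category.assoc, ← Functor.map_comp, h₁]
  simp

lemma tensorRight_tensor_eq_zero {f : GrEnd X n} {Z : C} (h : f.tensorRight Z = 0) (W : C) :
    f.tensorRight (Z ⊗ W) = 0 := by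
  have := (intertwines_associator₁ X Z W f).inv
  rw [h, tensorRight_zero] at this
  exact this.eq (Intertwines.zero _)

lemma tensorRight_tensor_eq_zero' {f : GrEnd X n} {Z : C} (h : f.tensorRight Z = 0) (W : C) :
    f.tensorRight (W ⊗ Z) = 0 := by
  have := intertwines_whiskerLeft (X := X) (β_ W Z).hom f
  rw [tensorRight_tensor_eq_zero h W] at this
  exact this.eq (Intertwines.zero _)

/-- Commuting the two middle factors gives (fg)² = u • f²g². -/
lemma mulOfEq_sq_eq_zero {f : GrEnd X m} {g : GrEnd X n} (h : m + n = k) {u : ℤˣ}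
    (hc : f.mulOfEq g h = u • g.mulOfEq f (by rw [add_comm, h]))
    (h0 : f.mulOfEq f rfl = 0 ∨ g.mulOfEq g rfl = 0) :
    (f.mulOfEq g h).mulOfEq (f.mulOfEq g h) rfl = 0 := by
  have hu : u * u = 1 := Int.units_mul_self u
  have hc' : g.mulOfEq f (by rw [add_comm, h]) = u • f.mulOfEq g h := by
    rw [hc, smul_smul, hu, one_smul]
  rw [mulOfEq_assoc f g (f.mulOfEq g h) h (np := n + k) rfl (by rw [h]),
    ← mulOfEq_assoc g f g (by rw [add_comm, h]) h (by rw [add_assoc, h]), hc',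
    units_smul_mulOfEq, mulOfEq_units_smul]
  rcases h0 with h0 | h0
  · rw [mulOfEq_assoc f g g h rfl (by rw [← h]; ring),
      ← mulOfEq_assoc f f (g.mulOfEq g rfl) rfl (by rw [← h]; ring) (by rw [← h]; ring), h0,
      zero_mulOfEq, smul_zero]
  · rw [mulOfEq_assoc f g g h rfl (by rw [← h]; ring), h0, mulOfEq_zero, mulOfEq_zero, smul_zero]

/-- A word of length three in f and g repeats a letter, and signed commutation brings the two copies
together. -/
lemma cube_add_eq_zero {f g : GrEnd X n} {u : ℤˣ} (hc : f.mulOfEq g rfl = u • g.mulOfEq f rfl)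
    (hf : f.mulOfEq f rfl = 0) (hg : g.mulOfEq g rfl = 0) :
    (mulOfEq (f + g) (f + g) rfl).mulOfEq (f + g) rfl = 0 := by
  have hu : u * u = 1 := Int.units_mul_self u
  have hc' : g.mulOfEq f rfl = u • f.mulOfEq g rfl := by
    rw [hc, smul_smul, hu, one_smul]
  have h₁ : (g.mulOfEq f rfl).mulOfEq f rfl = 0 := by
    rw [mulOfEq_assoc g f f rfl rfl rfl, hf, mulOfEq_zero]
  have h₂ : (f.mulOfEq g rfl).mulOfEq g rfl = 0 := by
    rw [mulOfEq_assoc f g g rfl rfl rfl, hg, mulOfEq_zero]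
  have h₃ : (f.mulOfEq g rfl).mulOfEq f rfl = 0 := by
    rw [hc, units_smul_mulOfEq, h₁, smul_zero]
  have h₄ : (g.mulOfEq f rfl).mulOfEq g rfl = 0 := by
    rw [hc', units_smul_mulOfEq, h₂, smul_zero]
  simp only [add_mulOfEq, mulOfEq_add, hf, hg, h₁, h₂, h₃, h₄, zero_mulOfEq, add_zero]

end GrEnd

/-! ### Primality of the non-invertible classes -/

namespace TensorFamily

variable {F : TensorFamily C} {m n k : ℤ}

/-- A class `[f]` is invertible at `P` if the cone of `f` belongs to `P`. -/
def IsInvertibleAt (P : suppFamily F.carrier) : F.Component n → Prop :=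
  Quot.lift (fun x => P.1.carrier.trW x.map.1) (by
    rintro _ _ (⟨a, X, ha, hX, h, f⟩ | ⟨a, X, ha, hX, h, f⟩)
    · exact propext (Spc.trW_tensorLeft_iff (Spc.notMem_of_mem P ha)).symm
    · exact propext (Spc.trW_tensorRight_iff (Spc.notMem_of_mem P ha)).symm)

variable {P : suppFamily F.carrier}

lemma isInvertibleAt_mk {X : C} (hX : X ∈ F.carrier) (f : GrBalanced X n) :
    IsInvertibleAt (F := F) P (.mk hX f) ↔ P.1.carrier.trW f.1 := Iff.rfl

/-- Two classes have representatives which commute up to the Koszul sign. -/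
lemma exists_commuting_rep (x : F.Component m) (y : F.Component n) :
    ∃ (X : C) (hX : X ∈ F.carrier) (f : GrBalanced X m) (g : GrBalanced X n),
      x = .mk hX f ∧ y = .mk hX g ∧ ∀ (k : ℤ) (h : m + n = k),
        f.1.mulOfEq g.1 h = (m * n).negOnePow • g.1.mulOfEq f.1 (by rw [add_comm, h]) := by
  obtain ⟨X, hX, f, rfl⟩ := exists_rep x
  obtain ⟨Y, hY, g, rfl⟩ := exists_rep y
  exact ⟨_, F.tensor_mem X hX Y hY, _, _, (mk_tensorRight hY hX f).symm,
    (mk_tensorLeft hX hY g).symm, fun k h => GrEnd.tensorRight_mulOfEq_tensorLeft f.1 g.1 h⟩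

lemma not_isInvertibleAt_zero : ¬ IsInvertibleAt P (0 : F.Component n) := fun h =>
  Spc.notMem_of_mem P F.nonempty.some_mem (Spc.carrier_of_trW_zero h)

lemma isInvertibleAt_one : IsInvertibleAt P (1 : F.Component 0) :=
  (P.1.carrier.trW.cancel_left_of_respectsIso _ _).2 (P.1.carrier.trW_of_isIso (𝟙 _))

/-- One direction is closure under composition. For the other, tensoring with an object that makes
f² or g² vanish turns fg into a morphism that is invertible at P and has square zero. -/
lemma isInvertibleAt_mulOfEq (h : m + n = k) (x : F.Component m) (y : F.Component n) :
    IsInvertibleAt P (mulOfEq h x y) ↔ IsInvertibleAt P x ∧ IsInvertibleAt P y := by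
  obtain ⟨X, hX, f, g, rfl, rfl, hc⟩ := exists_commuting_rep x y
  rw [mulOfEq_mk_same, isInvertibleAt_mk, isInvertibleAt_mk, isInvertibleAt_mk]
  refine ⟨fun hfg => ?_, fun hfg => Spc.trW_mulOfEq hfg.1 hfg.2 h⟩
  have key (R : C) (hR : (f.1.mulOfEq f.1 rfl).tensorRight R = 0 ∨
      (g.1.mulOfEq g.1 rfl).tensorRight R = 0) : P.1.carrier R := by
    have h0 := GrEnd.mulOfEq_sq_eq_zero (f := f.1.tensorRight R) (g := g.1.tensorRight R)
      (u := (m * n).negOnePow) h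
      (by rw [← GrEnd.tensorRight_mulOfEq, hc k h, GrEnd.tensorRight_units_smul,
        GrEnd.tensorRight_mulOfEq])
      (by simpa only [← GrEnd.tensorRight_mulOfEq] using hR)
    have h1 := Spc.trW_tensorRight hfg R
    change P.1.carrier.trW ((f.1.mulOfEq g.1 h).tensorRight R) at h1
    rw [GrEnd.tensorRight_mulOfEq] at h1
    have h2 := Spc.trW_mulOfEq h1 h1 rfl
    rw [h0] at h2
    -- The zero endomorphism of X ⊗ R is invertible at P, so X ⊗ R lies in P, while X does not.
    exact (P.1.prime _ _ (Spc.carrier_of_trW_zero h2)).resolve_left (Spc.notMem_of_mem P hX)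
  obtain ⟨R, hR, hR'⟩ := GrEnd.IsBalanced.exists_sq_zero f.2
  obtain ⟨S, hS, hS'⟩ := GrEnd.IsBalanced.exists_sq_zero g.2
  exact ⟨(hR P.1).2 (key R (Or.inl hR')), (hS P.1).2 (key S (Or.inr hS'))⟩

/-- Both squares vanish on R ⊗ S, hence so does (f + g)³. Invertibility at P then puts X ⊗ (R ⊗ S)
in P, and primality puts R or S there. -/
lemma isInvertibleAt_of_add (x y : F.Component n) (h : IsInvertibleAt P (x + y)) :
    IsInvertibleAt P x ∨ IsInvertibleAt P y := by
  obtain ⟨X, hX, f, g, rfl, rfl, hc⟩ := exists_commuting_rep x y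
  rw [← mk_add] at h
  rw [isInvertibleAt_mk] at h ⊢
  rw [isInvertibleAt_mk]
  obtain ⟨R, hR, hR'⟩ := GrEnd.IsBalanced.exists_sq_zero f.2
  obtain ⟨S, hS, hS'⟩ := GrEnd.IsBalanced.exists_sq_zero g.2
  rw [hR, hS]
  have h0 := GrEnd.cube_add_eq_zero (f := f.1.tensorRight (R ⊗ S))
    (g := g.1.tensorRight (R ⊗ S)) (u := (n * n).negOnePow)
    (by rw [← GrEnd.tensorRight_mulOfEq, hc _ rfl, GrEnd.tensorRight_units_smul,
      GrEnd.tensorRight_mulOfEq])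
    (by rw [← GrEnd.tensorRight_mulOfEq, GrEnd.tensorRight_tensor_eq_zero hR'])
    (by rw [← GrEnd.tensorRight_mulOfEq, GrEnd.tensorRight_tensor_eq_zero' hS'])
  have h1 := Spc.trW_tensorRight h (R ⊗ S)
  change P.1.carrier.trW (GrEnd.tensorRight (f.1 + g.1) (R ⊗ S)) at h1
  rw [GrEnd.tensorRight_add] at h1
  have h2 := Spc.trW_mulOfEq (Spc.trW_mulOfEq h1 h1 rfl) h1 rfl
  rw [h0] at h2
  exact P.1.prime _ _ ((P.1.prime _ _ (Spc.carrier_of_trW_zero h2)).resolve_left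
    (Spc.notMem_of_mem P hX))

end TensorFamily

end ConeInPrime

/-! ### Direct sums as internally graded rings -/

noncomputable section InternalGrading

open DirectSum

variable (A : ℤ → Type*) [∀ n, AddCommGroup (A n)]

/-- The homogeneous components of a direct sum. -/
def homogeneousPart (n : ℤ) : AddSubgroup (⨁ n, A n) := (DirectSum.of A n).range

/-- The identification of the summands of a direct sum with its homogeneous components. -/
def homogeneousPartEquiv (n : ℤ) : A n ≃ homogeneousPart A n :=
  (AddMonoidHom.ofInjective (DirectSum.of_injective n)).toEquiv

lemma coe_homogeneousPartEquiv {n : ℤ} (a : A n) :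
    (homogeneousPartEquiv A n a : ⨁ n, A n) = DirectSum.of A n a := rfl

variable [DirectSum.GRing A]

instance : GradedRing (homogeneousPart A) where
  one_mem := ⟨GradedMonoid.GOne.one, rfl⟩
  mul_mem := by
    rintro m n _ _ ⟨a, rfl⟩ ⟨b, rfl⟩
    exact ⟨GradedMonoid.GMul.mul a b, (DirectSum.of_mul_of a b).symm⟩
  toDecomposition := Decomposition.ofAddHom (homogeneousPart A)
    (DirectSum.toAddMonoid fun n =>
      (DirectSum.of (fun n => homogeneousPart A n) n).comp (DirectSum.of A n).rangeRestrict)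
    (DirectSum.addHom_ext fun n a => by
      simp only [AddMonoidHom.comp_apply, DirectSum.toAddMonoid_of]
      exact DirectSum.coeAddMonoidHom_of (homogeneousPart A) n _)
    (DirectSum.addHom_ext fun n a => by
      obtain ⟨_, a, rfl⟩ := a
      simp only [AddMonoidHom.comp_apply, DirectSum.coeAddMonoidHom_of, DirectSum.toAddMonoid_of]
      rfl)

end InternalGrading

/-! ### The graded ring, its degree zero part, and the comparison maps -/

noncomputable section RingStructure

variable {C : Type u} [Category.{v} C] [Preadditive C] [HasZeroObject C]
  [HasShift C ℤ] [∀ n : ℤ, (shiftFunctor C n).Additive] [Pretriangulated C] [IsTriangulated C]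
  [MonoidalCategory C] [SymmetricCategory C] [(curriedTensor C).CommShift₂Int]
  [IsTensorTriangulated C]

namespace TensorFamily

variable (F : TensorFamily C)

instance : GradedMonoid.GMul F.Component := ⟨fun x y => mulOfEq rfl x y⟩

instance : GradedMonoid.GOne F.Component := ⟨1⟩

variable {F}

lemma gradedMonoid_mul {m n k : ℤ} (x : F.Component m) (y : F.Component n) (h : m + n = k) :
    GradedMonoid.mk m x * GradedMonoid.mk n y = GradedMonoid.mk k (mulOfEq h x y) := by
  subst h
  rfl

instance : DirectSum.GRing F.Component where
  one_mul x := (gradedMonoid_mul 1 x.2 (zero_add _)).trans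
    (congrArg (GradedMonoid.mk x.1) (one_mulOfEq x.2))
  mul_one x := (gradedMonoid_mul x.2 1 (add_zero _)).trans
    (congrArg (GradedMonoid.mk x.1) (mulOfEq_one x.2))
  mul_assoc x y z := by
    rw [show x * y = GradedMonoid.mk _ (mulOfEq rfl x.2 y.2) from rfl,
      show y * z = GradedMonoid.mk _ (mulOfEq rfl y.2 z.2) from rfl]
    exact (gradedMonoid_mul _ z.2 rfl).trans <| (congrArg (GradedMonoid.mk _)
      (mulOfEq_assoc x.2 y.2 z.2 rfl rfl rfl)).trans (gradedMonoid_mul x.2 _ _).symm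
  mul_zero x := mulOfEq_zero rfl x
  zero_mul x := zero_mulOfEq rfl x
  mul_add x y z := mulOfEq_add rfl x y z
  add_mul x y z := add_mulOfEq rfl x y z
  natCast n := n • 1
  natCast_zero := zero_nsmul 1
  natCast_succ n := succ_nsmul 1 n
  intCast n := n • 1
  intCast_ofNat n := natCast_zsmul 1 n
  intCast_negSucc_ofNat n := negSucc_zsmul 1 n

variable (F)

/-- The graded ring of a multiplicative family. -/
abbrev TotalRing : Type (max u v) := DirectSum ℤ F.Component

/-- The homogeneous components of the graded ring of a multiplicative family. -/
abbrev grading : ℤ → AddSubgroup F.TotalRing := homogeneousPart F.Component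

variable {F}

lemma coe_equiv_mul_coe_equiv {m n k : ℤ} (h : m + n = k) (x : F.Component m) (y : F.Component n) :
    (homogeneousPartEquiv F.Component m x : F.TotalRing) * homogeneousPartEquiv F.Component n y =
      homogeneousPartEquiv F.Component k (mulOfEq h x y) := by
  subst h
  exact DirectSum.of_mul_of x y

lemma isGradedCommutative : IsGradedCommutative F.grading := by
  rintro m n _ _ ⟨x, rfl⟩ ⟨y, rfl⟩
  refine (coe_equiv_mul_coe_equiv rfl x y).trans ?_
  rw [mulOfEq_comm]
  refine Eq.trans ?_ (congrArg _ (coe_equiv_mul_coe_equiv (add_comm n m) y x).symm)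
  rcases Int.units_eq_one_or (m * n).negOnePow with h | h <;>
    simp [h, Units.smul_def, coe_homogeneousPartEquiv]

lemma isClassGradedRing :
    IsClassGradedRing F.carrier F.tensor_mem F.grading (homogeneousPartEquiv F.Component) where
  add _ _ _ _ := (map_add (DirectSum.of F.Component _) _ _).symm
  mul _ _ _ _ := coe_equiv_mul_coe_equiv rfl _ _

/-- The identification of `E_X⁰` with `E_X`. -/
def toEnd {X : C} (f : GrBalanced X 0) : balancedEnd X :=
  ⟨(shiftFunctorZero C ℤ).inv.app X ≫ f.1, by
    have hf : GrEnd.tensorRight f.1 X = GrEnd.tensorLeft X f.1 := f.2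
    have h : f.1 = GrEnd.ofEnd ((shiftFunctorZero C ℤ).inv.app X ≫ f.1) := by
      simp [GrEnd.ofEnd]
    rw [h, GrEnd.tensorRight_ofEnd, GrEnd.tensorLeft_ofEnd] at hf
    exact (cancel_epi ((shiftFunctorZero C ℤ).hom.app (X ⊗ X))).1 hf⟩

lemma ofEnd_toEnd {X : C} (f : GrBalanced X 0) : GrBalanced.ofEnd (toEnd f) = f :=
  Subtype.ext (by simp [GrBalanced.ofEnd, GrEnd.ofEnd, toEnd])

lemma toEnd_ofEnd {X : C} (f : balancedEnd X) : toEnd (GrBalanced.ofEnd f) = f :=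
  Subtype.ext (by simp [GrBalanced.ofEnd, GrEnd.ofEnd, toEnd])

lemma ofEnd_tensorLeft {X : C} (a : C) (f : balancedEnd X) :
    GrBalanced.ofEnd (balancedEnd.tensorLeft a f) =
      GrBalanced.tensorLeft a (GrBalanced.ofEnd f) :=
  Subtype.ext (GrEnd.tensorLeft_ofEnd _ _).symm

lemma ofEnd_tensorRight {X : C} (a : C) (f : balancedEnd X) :
    GrBalanced.ofEnd (balancedEnd.tensorRight f a) =
      GrBalanced.tensorRight (GrBalanced.ofEnd f) a :=
  Subtype.ext (GrEnd.tensorRight_ofEnd _ _).symm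

lemma ofEnd_add {X : C} (f g : balancedEnd X) :
    GrBalanced.ofEnd (f + g) = GrBalanced.ofEnd f + GrBalanced.ofEnd g :=
  Subtype.ext (Preadditive.comp_add _ _ _ _ _ _)

lemma ofEnd_mul {X : C} (f g : balancedEnd X) :
    GrBalanced.ofEnd (f * g) =
      GrBalanced.mulOfEq (GrBalanced.ofEnd f) (GrBalanced.ofEnd g) (zero_add 0) :=
  Subtype.ext (GrEnd.ofEnd_mul f.1 g.1)

variable (F)

/-- The identification of the ungraded classes with the classes of degree zero. -/
def ringClassEquiv : RingClass F.carrier ≃ F.Component 0 where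
  toFun := Quot.lift (fun x => .mk x.mem (GrBalanced.ofEnd x.map)) (by
    rintro _ _ (⟨a, X, ha, hX, h, f⟩ | ⟨a, X, ha, hX, h, f⟩)
    · rw [ofEnd_tensorLeft, mk_tensorLeft ha hX]
    · rw [ofEnd_tensorRight, mk_tensorRight ha hX])
  invFun := Quot.lift (fun x => .mk x.mem (toEnd x.map)) (by
    rintro _ _ (⟨a, X, ha, hX, h, f⟩ | ⟨a, X, ha, hX, h, f⟩)
    · refine (Quot.sound (.left a X ha hX h (toEnd f))).trans (congrArg (RingClass.mk h) ?_)
      rw [← toEnd_ofEnd (balancedEnd.tensorLeft a (toEnd f)), ofEnd_tensorLeft, ofEnd_toEnd]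
    · refine (Quot.sound (.right a X ha hX h (toEnd f))).trans (congrArg (RingClass.mk h) ?_)
      rw [← toEnd_ofEnd (balancedEnd.tensorRight (toEnd f) a), ofEnd_tensorRight, ofEnd_toEnd])
  left_inv := by
    rintro ⟨X, hX, f⟩
    exact congrArg (RingClass.mk hX) (toEnd_ofEnd f)
  right_inv := by
    rintro ⟨X, hX, f⟩
    exact congrArg (GrRingClass.mk hX) (ofEnd_toEnd f)

/-- The identification of the ungraded classes with the homogeneous elements of degree zero. -/
def degreeZeroEquiv : RingClass F.carrier ≃ F.grading 0 :=
  (ringClassEquiv F).trans (homogeneousPartEquiv F.Component 0)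

/-- The structure is transported along the bijection with degree zero, so that bijection is a ring
isomorphism by construction; the expected formulas are checked in `isClassRing`. Commutativity is
the case of sign (-1)⁰. -/
instance : CommRing (RingClass F.carrier) where
  __ := (degreeZeroEquiv F).ring
  mul_comm x y := by
    have h := isGradedCommutative (F := F) 0 0 _ _ (degreeZeroEquiv F x).2 (degreeZeroEquiv F y).2
    rw [mul_zero, Int.negOnePow_zero, one_smul] at h
    exact congrArg (degreeZeroEquiv F).symm (Subtype.ext h)

/-- The identification of the ungraded ring with the homogeneous part of degree zero. -/
def degreeZeroRingEquiv : RingClass F.carrier ≃+* F.grading 0 where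
  __ := degreeZeroEquiv F
  map_mul' _ _ := (degreeZeroEquiv F).apply_symm_apply _
  map_add' _ _ := (degreeZeroEquiv F).apply_symm_apply _

lemma degreeZeroRingEquiv_mk {X : C} (hX : X ∈ F.carrier) (f : balancedEnd X) :
    degreeZeroRingEquiv F (.mk hX f) =
      homogeneousPartEquiv F.Component 0 (.mk hX (GrBalanced.ofEnd f)) := rfl

lemma isClassRing : IsClassRing F.carrier F.tensor_mem where
  add {X Y} hX hY f g := by
    apply (degreeZeroRingEquiv F).injective
    rw [map_add]
    refine Subtype.ext ?_
    simp only [degreeZeroRingEquiv_mk, ofEnd_add, ofEnd_tensorLeft, ofEnd_tensorRight]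
    exact isClassGradedRing.add hX hY _ _
  mul {X Y} hX hY f g := by
    apply (degreeZeroRingEquiv F).injective
    rw [map_mul]
    refine Subtype.ext ?_
    simp only [degreeZeroRingEquiv_mk, ofEnd_mul, ofEnd_tensorLeft, ofEnd_tensorRight]
    exact coe_equiv_mul_coe_equiv (zero_add 0) _ _

/-! ### The comparison maps -/

variable {F}

/-- The homogeneous elements which are not invertible at a prime. -/
def NotInvertibleAt (P : suppFamily F.carrier) (n : ℤ) (a : F.TotalRing) : Prop :=
  ∃ x : F.Component n, a = homogeneousPartEquiv F.Component n x ∧ ¬ IsInvertibleAt P x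

lemma notInvertibleAt_coe {P : suppFamily F.carrier} {n : ℤ} {x : F.Component n} :
    NotInvertibleAt P n (homogeneousPartEquiv F.Component n x) ↔ ¬ IsInvertibleAt P x := by
  refine ⟨?_, fun h => ⟨x, rfl, h⟩⟩
  rintro ⟨y, hy, h⟩
  rwa [(homogeneousPartEquiv F.Component n).injective (Subtype.ext hy)]

lemma isPrimeFamily (P : suppFamily F.carrier) :
    HomogeneousSpectrum.IsPrimeFamily F.grading (NotInvertibleAt P) where
  zero n := ⟨0, (map_zero (DirectSum.of F.Component n)).symm, not_isInvertibleAt_zero⟩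
  add := by
    rintro n _ _ - - ⟨x, rfl, hx⟩ ⟨y, rfl, hy⟩
    exact ⟨x + y, (map_add (DirectSum.of F.Component n) x y).symm,
      fun h => (isInvertibleAt_of_add x y h).elim hx hy⟩
  mul_left := by
    rintro m n _ _ ⟨x, rfl⟩ - ⟨y, rfl, hy⟩
    exact ⟨mulOfEq rfl x y, coe_equiv_mul_coe_equiv rfl x y,
      fun h => hy ((isInvertibleAt_mulOfEq rfl x y).1 h).2⟩
  mul_right := by
    rintro m n _ _ - ⟨y, rfl⟩ ⟨x, rfl, hx⟩
    exact ⟨mulOfEq rfl x y, coe_equiv_mul_coe_equiv rfl x y,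
      fun h => hx ((isInvertibleAt_mulOfEq rfl x y).1 h).1⟩
  one h := (notInvertibleAt_coe (x := 1)).1 h isInvertibleAt_one
  mem_or_mem := by
    rintro m n _ _ ⟨x, rfl⟩ ⟨y, rfl⟩ h
    have h' := coe_equiv_mul_coe_equiv rfl x y
    rw [← coe_homogeneousPartEquiv, ← coe_homogeneousPartEquiv, h', notInvertibleAt_coe,
      isInvertibleAt_mulOfEq, not_and_or] at h
    exact h.imp notInvertibleAt_coe.2 notInvertibleAt_coe.2

variable (F)

/-- The graded comparison map. -/
def gradedComparison (P : suppFamily F.carrier) : HomogeneousSpectrum F.grading :=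
  HomogeneousSpectrum.ofFamily (isPrimeFamily P)

variable {F}

lemma mem_gradedComparison {P : suppFamily F.carrier} {n : ℤ} {X : C} (hX : X ∈ F.carrier)
    (f : GrBalanced X n) :
    (homogeneousPartEquiv F.Component n (.mk hX f) : F.TotalRing) ∈
      (gradedComparison F P).ideal.toIdeal ↔ ¬ P.1.carrier (cone f.1) :=
  (HomogeneousSpectrum.mem_ofFamily _ (SetLike.coe_mem _)).trans <| notInvertibleAt_coe.trans <|
    not_congr (Spc.carrier_cone_iff P.1 f.1).symm

lemma gradedComparison_antitone {P Q : suppFamily F.carrier} (h : P.1.carrier ≤ Q.1.carrier) :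
    (gradedComparison F Q).ideal.toIdeal ≤ (gradedComparison F P).ideal.toIdeal := by
  intro a ha
  rw [(gradedComparison F Q).ideal.isHomogeneous.mem_iff] at ha
  rw [(gradedComparison F P).ideal.isHomogeneous.mem_iff]
  intro n
  obtain ⟨x, hx⟩ := (homogeneousPartEquiv F.Component n).surjective
    (DirectSum.decompose F.grading a n)
  have hn := ha n
  rw [← hx] at hn ⊢
  obtain ⟨X, hX, f, rfl⟩ := exists_rep x
  rw [mem_gradedComparison] at hn ⊢
  exact fun hP => hn (h _ hP)

/-- The primes P whose image omits [f] are those containing cone(f), which is a single member of the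
subbasis of Z_Φ. -/
lemma isSpectralMap_gradedComparison : IsSpectralMap (gradedComparison F) := by
  have key (a : {a : F.TotalRing // SetLike.IsHomogeneousElem F.grading a}) :
      ∃ c : C, gradedComparison F ⁻¹' HomogeneousSpectrum.basicOpen F.grading a =
        Spc.basicOpen F.carrier c := by
    obtain ⟨_, n, x, rfl⟩ := a
    obtain ⟨X, hX, f, rfl⟩ := exists_rep x
    exact ⟨cone f.1, Set.ext fun P => not_iff_comm.1 (mem_gradedComparison hX f).symm⟩
  choose σ hσ using key
  exact (Spc.isSpectralSubbasis_basicOpen F.carrier).isSpectralMap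
    (HomogeneousSpectrum.eq_generateFrom_basicOpen F.grading) hσ

/-- Passing to degree zero precomposes f with the isomorphism Σ⁰X ≅ X, which does not affect whether
its cone lies in P. -/
lemma mem_degreeZero_gradedComparison {P : suppFamily F.carrier} {X : C} (hX : X ∈ F.carrier)
    (f : balancedEnd X) :
    RingClass.mk hX f ∈
        ((gradedComparison F P).degreeZero (degreeZeroRingEquiv F)).asIdeal ↔
      ¬ P.1.carrier (cone (X := X) (Y := X) f.1) := by
  refine (mem_gradedComparison hX (GrBalanced.ofEnd f)).trans (not_congr ?_)
  rw [Spc.carrier_cone_iff, Spc.carrier_cone_iff]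
  exact Spc.trW_ofEnd_iff

end TensorFamily

end RingStructure

end TensorTriangular

theorem mainTheorem2 {C : Type u} [Category.{v} C] [Preadditive C] [HasZeroObject C]
    [HasShift C ℤ] [∀ n : ℤ, (shiftFunctor C n).Additive] [Pretriangulated C] [IsTriangulated C]
    [MonoidalCategory C] [SymmetricCategory C] [(curriedTensor C).CommShift₂Int]
    [TensorTriangular.IsTensorTriangulated C]
    (Φ : Set C) (hne : Φ.Nonempty) (hΦ : ∀ a ∈ Φ, ∀ b ∈ Φ, a ⊗ b ∈ Φ) :
    -- the commutative ring `R_Φ`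
    ∃ (_ : CommRing (TensorTriangular.RingClass Φ))
      (_ : TensorTriangular.IsClassRing Φ hΦ)
      -- the graded ring `R_Φ^•`
      (A : Type (max u v)) (_ : Ring A) (𝒜 : ℤ → AddSubgroup A) (_ : GradedRing 𝒜)
      (κ : ∀ n : ℤ, TensorTriangular.GrRingClass Φ n ≃ 𝒜 n)
      (_ : TensorTriangular.IsClassGradedRing Φ hΦ 𝒜 κ)
      (_ : TensorTriangular.IsGradedCommutative 𝒜)
      -- the identification of `R_Φ` with the degree zero part of `R_Φ^•`
      (e : TensorTriangular.RingClass Φ ≃+* 𝒜 0)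
      (_ : ∀ (X : C) (hX : X ∈ Φ) (f : TensorTriangular.balancedEnd X),
        e (.mk hX f) = κ 0 (.mk hX (TensorTriangular.GrBalanced.ofEnd f)))
      -- the graded and the ungraded comparison map
      (ρgr : TensorTriangular.suppFamily Φ → TensorTriangular.HomogeneousSpectrum 𝒜)
      (ρ : TensorTriangular.suppFamily Φ → PrimeSpectrum (TensorTriangular.RingClass Φ)),
      (∀ (P : TensorTriangular.suppFamily Φ) (n : ℤ) (X : C) (hX : X ∈ Φ)
        (f : TensorTriangular.GrBalanced X n),
        (κ n (.mk hX f) : A) ∈ (ρgr P).ideal.toIdeal ↔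
          ¬ P.1.carrier (TensorTriangular.cone f.1)) ∧
      (∀ (P : TensorTriangular.suppFamily Φ) (X : C) (hX : X ∈ Φ)
        (f : TensorTriangular.balancedEnd X),
        TensorTriangular.RingClass.mk hX f ∈ (ρ P).asIdeal ↔
          ¬ P.1.carrier (TensorTriangular.cone (X := X) (Y := X) f.1)) ∧
      (∀ P Q : TensorTriangular.suppFamily Φ, P.1.carrier ≤ Q.1.carrier →
        (ρgr Q).ideal.toIdeal ≤ (ρgr P).ideal.toIdeal) ∧
      SpectralSpace (TensorTriangular.suppFamily Φ) ∧
      SpectralSpace (TensorTriangular.HomogeneousSpectrum 𝒜) ∧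
      IsSpectralMap ρgr ∧
      Function.Surjective (TensorTriangular.HomogeneousSpectrum.degreeZero e) ∧
      IsSpectralMap (TensorTriangular.HomogeneousSpectrum.degreeZero e) ∧
      TensorTriangular.HomogeneousSpectrum.degreeZero e ∘ ρgr = ρ := by
  -- The ring structures depend on non-emptiness and closure under ⊗, so Φ is bundled with these
  -- properties.
  obtain ⟨F, rfl⟩ : ∃ F : TensorTriangular.TensorFamily C, F.carrier = Φ := ⟨⟨Φ, hne, hΦ⟩, rfl⟩
  exact ⟨inferInstanceAs (CommRing (TensorTriangular.RingClass F.carrier)), F.isClassRing,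
    F.TotalRing, inferInstance, F.grading, inferInstance, _,
    TensorTriangular.TensorFamily.isClassGradedRing,
    TensorTriangular.TensorFamily.isGradedCommutative, F.degreeZeroRingEquiv,
    fun X hX f => F.degreeZeroRingEquiv_mk hX f, F.gradedComparison,
    -- The ungraded map is taken to be the composite, so compatibility is `rfl` and the content lies
    -- in the description of its values by cones.
    TensorTriangular.HomogeneousSpectrum.degreeZero F.degreeZeroRingEquiv ∘ F.gradedComparison,
    fun P n X hX f => TensorTriangular.TensorFamily.mem_gradedComparison hX f,
    fun P X hX f => TensorTriangular.TensorFamily.mem_degreeZero_gradedComparison hX f,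
    fun P Q h => TensorTriangular.TensorFamily.gradedComparison_antitone h,
    inferInstance, inferInstance,
    TensorTriangular.TensorFamily.isSpectralMap_gradedComparison,
    TensorTriangular.HomogeneousSpectrum.surjective_degreeZero _
      TensorTriangular.TensorFamily.isGradedCommutative,
    TensorTriangular.HomogeneousSpectrum.isSpectralMap_degreeZero _, rfl⟩
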